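/- Let $\mathbb{D}=\{z\in\mathbb{C}:|z|<1\}$. For functions $f,g$ analytic in $\mathbb{D}$ write $f\prec g$ ($f$ is subordinate to $g$) if there is an analytic $w:\mathbb{D}\to\mathbb{D}$ with $w(0)=0$ and $f(z)=g(w(z))$ for all $z\in\mathbb{D}$. Put $\varphi_{Ne}(z)=1+z-\frac{z^3}{3}$ and consider the following pairs $(\varphi,b)$ of a function $\varphi$ and a number $b$: (a) $\varphi(z)=z+\sqrt{1+z^2}$ (principal branch), $\ b=\frac49(2+\sqrt2)$; (b) $\varphi(z)=1+\frac43z+\frac23z^2$, $\ b=\frac43$; (c) $\varphi(z)=1+\sqrt2\,z+\frac12z^2$, $\ b=\frac{8}{63}(5+4\sqrt2)$; (d) $\varphi(z)=e^z$, $\ b=\frac{8e}{9(e-1)}$; (e) $\varphi(z)=1+\sin z$, $\ b=\frac{8(1+\sin 1)}{9\sin 1}$; (f) $\varphi(z)=1+\frac zk\left(\frac{k+z}{k-z}\right)$ with $k=1+\sqrt2$, $\ b=\frac{16}{9}(1+\sqrt2)$; (g) $\varphi=\varphi_{Ne}$, $\ b=\frac{20}{9}$. For each of these seven pairs the following hold.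 1. If $\beta\ge b$ is real and $p$ is analytic in $\mathbb{D}$ with $p(0)=1$ and $1+\beta\,\dfrac{zp'(z)}{p(z)^2}\prec\varphi_{Ne}(z)$, then $p\prec\varphi$. The bound is sharp: for every $\beta$ with $0<\beta<b$ there is a zero-free analytic $p$ in $\mathbb{D}$ with $p(0)=1$ and $1+\beta\,\dfrac{zp'(z)}{p(z)^2}\prec\varphi_{Ne}(z)$ such that $p\not\prec\varphi$. 2. If $\beta\ge b$ is real, $f$ is analytic in $\mathbb{D}$ with $f(0)=0$ and $f'(0)=1$, and $$1+\beta\left(\frac{zf'(z)}{f(z)}\right)^{-1}\left(1-\frac{zf'(z)}{f(z)}+\frac{zf''(z)}{f'(z)}\right)\prec\varphi_{Ne}(z),$$ then $\dfrac{zf'(z)}{f(z)}\prec\varphi(z)$, that is, $f$ belongs to the starlike class $\mathcal{S}^*(\varphi)$. Here $zf'(z)/f(z)$ is given the value $1$ at $z=0$. The bound is sharp: for every $\beta$ with $0<\beta<b$ there is an analytic $f$ in $\mathbb{D}$ with $f(0)=0$, $f'(0)=1$, $f(z)\ne0$ for $0<|z|<1$ and $f'(z)\neq 0$ for $z\in\mathbb{D}$,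 which satisfies this hypothesis but does not belong to $\mathcal{S}^*(\varphi)$. (The hypotheses are understood to include that the displayed quotients are defined: $p$ has no zeros in $\mathbb{D}$, respectively $f$ has no zeros in $\mathbb{D}\setminus\{0\}$ and $f'$ none in $\mathbb{D}$.) -/

import Mathlib

noncomputable section

/-- The open unit disk of the complex plane. -/
def unitDisk : Set ℂ := Metric.ball (0 : ℂ) 1

/-- Subordination of `f` to `g` on the unit disk: `f = g ∘ w` on the disk for some analytic `w`
with `w 0 = 0` and `‖w z‖ < 1` there. -/
def Subordinate (f g : ℂ → ℂ) : Prop :=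
  ∃ w : ℂ → ℂ, DifferentiableOn ℂ w unitDisk ∧ w 0 = 0 ∧
    (∀ z ∈ unitDisk, ‖w z‖ < 1) ∧ ∀ z ∈ unitDisk, f z = g (w z)

/-- The nephroid function. -/
def phiNe (z : ℂ) : ℂ := 1 + z - z ^ 3 / 3

/-- The crescent function `z + √(1 + z²)` (principal branch). -/
def phiCrescent (z : ℂ) : ℂ := z + Complex.sqrt (1 + z ^ 2)

/-- The cardioid function. -/
def phiCardioid (z : ℂ) : ℂ := 1 + 4 / 3 * z + 2 / 3 * z ^ 2

/-- The limaçon function. -/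
def phiLimacon (z : ℂ) : ℂ := 1 + (Real.sqrt 2 : ℂ) * z + z ^ 2 / 2

/-- The sine function `1 + sin z`. -/
def phiSin (z : ℂ) : ℂ := 1 + Complex.sin z

/-- The rational function `1 + (z / k) (k + z) / (k - z)` with `k = 1 + √2`. -/
def phiZero (z : ℂ) : ℂ :=
  1 + z / (1 + (Real.sqrt 2 : ℂ)) *
    ((1 + (Real.sqrt 2 : ℂ) + z) / (1 + (Real.sqrt 2 : ℂ) - z))

/-- The function `1 + β z p'(z) / p(z)²`. -/
def diffExpr (β : ℝ) (p : ℂ → ℂ) (z : ℂ) : ℂ := 1 + (β : ℂ) * (z * deriv p z / p z ^ 2)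

/-- Analytic functions on the unit disk normalised by `f 0 = 0` and `f' 0 = 1`. -/
def ClassA (f : ℂ → ℂ) : Prop :=
  DifferentiableOn ℂ f unitDisk ∧ f 0 = 0 ∧ deriv f 0 = 1

/-- The function `z f'(z) / f(z)`, with the removable singularity at `0` filled in by its
limit `1` (for `f` in the class above). -/
def starlikeQuot (f : ℂ → ℂ) (z : ℂ) : ℂ :=
  if z = 0 then 1 else z * deriv f z / f z

/-- The Ma-Minda type starlike class of `φ`. -/
def StarlikeClass (φ : ℂ → ℂ) (f : ℂ → ℂ) : Prop :=
  ClassA f ∧ Subordinate (starlikeQuot f) φ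

/-- The function `1 + β (z f' / f)⁻¹ (1 - z f' / f + z f'' / f')`. -/
def starlikeDiffExpr (β : ℝ) (f : ℂ → ℂ) (z : ℂ) : ℂ :=
  1 + (β : ℂ) * ((starlikeQuot f z)⁻¹ *
    (1 - starlikeQuot f z + z * deriv (deriv f) z / deriv f z))

/-- `b` is a valid and sharp bound for the implication
`1 + β z p' / p² ≺ φ_Ne ⟹ p ≺ φ`: the implication holds for all `β ≥ b`, and for each
`0 < β < b` it fails, for some zero-free `p`. -/
def SharpSubordinationBound (φ : ℂ → ℂ) (b : ℝ) : Prop :=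
  (∀ β : ℝ, b ≤ β → ∀ p : ℂ → ℂ, DifferentiableOn ℂ p unitDisk → p 0 = 1 →
    Subordinate (diffExpr β p) phiNe → Subordinate p φ) ∧
  (∀ β : ℝ, 0 < β → β < b → ∃ p : ℂ → ℂ, DifferentiableOn ℂ p unitDisk ∧ p 0 = 1 ∧
    (∀ z ∈ unitDisk, p z ≠ 0) ∧ Subordinate (diffExpr β p) phiNe ∧ ¬ Subordinate p φ)

/-- `b` is a valid and sharp bound for the implication
`1 + β (z f' / f)⁻¹ (1 - z f' / f + z f'' / f') ≺ φ_Ne ⟹ f` is in the starlike class of `φ`: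
the implication holds for all `β ≥ b`, and for each `0 < β < b` it fails, for some `f` for which
no denominator vanishes. -/
def SharpStarlikeBound (φ : ℂ → ℂ) (b : ℝ) : Prop :=
  (∀ β : ℝ, b ≤ β → ∀ f : ℂ → ℂ, ClassA f →
    Subordinate (starlikeDiffExpr β f) phiNe → StarlikeClass φ f) ∧
  (∀ β : ℝ, 0 < β → β < b → ∃ f : ℂ → ℂ, ClassA f ∧
    (∀ z ∈ unitDisk, z ≠ 0 → f z ≠ 0) ∧ (∀ z ∈ unitDisk, deriv f z ≠ 0) ∧
    Subordinate (starlikeDiffExpr β f) phiNe ∧ ¬ StarlikeClass φ f)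

end

/-! Put `F = β (1 - 1/p)`. Then `z F'(z) = β z p'(z) / p(z)²`, so the hypothesis says `z F'(z) = w -
w³/3` with `w` a self-map of the disk. The function `H(z) = z - z³/9` solves the same equation for
`w = z`, that is `z H'(z) = z - z³/3`.

Since the nephroid is starlike about its centre, `F` maps the disk into `H(𝔻)`
(`mem_image_nephroidPrimitive`). Otherwise take a point `z₀` of least modulus with `F(z₀) ∉ H(𝔻)`
and lift `F = H ∘ u` on the closed disk of radius `|z₀|`. Jack's lemma gives `z₀ u'(z₀) = m u(z₀)`
with `m ≥ 1` and `|u(z₀)| = 1`, so `z₀ F'(z₀)` is `m` times a boundary point of the nephroid, which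
starlikeness forbids.

As `φ` is injective on the disk, `p ≺ φ` follows once `p` avoids the values of `φ` on the unit
circle (`subordinate_of_avoid`). If `p(z) = φ(ζ)` with `|ζ| = 1`, then `β (1 - 1/φ(ζ)) ∈ H(𝔻)`. So
it suffices that `b (1 - 1/φ(ζ))` lies outside an explicit region containing `H(𝔻)` whose complement
is stable under real factors `≥ 1`; this covers all `β ≥ b`. For each `φ` this is an inequality on
the unit circle. Outside the region lie `|Re v| ≥ 8/9` and `|v| ≥ 10/9`, and these two tests suffice
except for the exponential.

The number `b` solves `b (1 - 1/φ(ε)) = H(ε) = 8ε/9`, with `ε = -1` for the rational function and `ε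
= 1` otherwise. For `β < b` the function `p = 1 / (1 - H(rz)/β)`, with suitable `r < 1`, attains the
boundary value `φ(ε)` inside the disk (`exists_not_subordinate`).

The starlike statements are the same statements for `p = z f'/f`. -/

open Filter Topology Metric

/-! ### Lifting through injective functions and a subordination test -/

/-- Holomorphic lifting through an injective holomorphic function. -/
theorem exists_holomorphic_lift {φ p : ℂ → ℂ} {U V : Set ℂ} (hU : IsOpen U) (hV : IsOpen V)
    (hφ : DifferentiableOn ℂ φ U) (hφ' : ∀ z ∈ U, deriv φ z ≠ 0) (hinj : Set.InjOn φ U)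
    (hp : DifferentiableOn ℂ p V) (hmaps : ∀ z ∈ V, p z ∈ φ '' U) :
    ∃ w : ℂ → ℂ, DifferentiableOn ℂ w V ∧ ∀ z ∈ V, w z ∈ U ∧ φ (w z) = p z := by
  choose! w hwU hw using hmaps
  refine ⟨w, fun z hz => ?_, fun z hz => ⟨hwU z hz, hw z hz⟩⟩
  have hstrict : HasStrictDerivAt φ (deriv φ (w z)) (w z) :=
    (hφ.analyticAt (hU.mem_nhds (hwU z hz))).hasStrictDerivAt
  have hne := hφ' _ (hwU z hz)
  set g := hstrict.localInverse φ (deriv φ (w z)) (w z) hne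
  have hg : HasStrictDerivAt g (deriv φ (w z))⁻¹ (φ (w z)) := hstrict.to_localInverse hne
  have hgw : g (φ (w z)) = w z :=
    HasStrictFDerivAt.localInverse_apply_image (hstrict.hasStrictFDerivAt_equiv hne)
  have hright : ∀ᶠ y in 𝓝 (φ (w z)), φ (g y) = y :=
    (hstrict.hasStrictFDerivAt_equiv hne).eventually_right_inverse
  have hgU : ∀ᶠ y in 𝓝 (φ (w z)), g y ∈ U := by
    refine hg.hasDerivAt.continuousAt.eventually_mem ?_
    rw [hgw]
    exact hU.mem_nhds (hwU z hz)
  have hpz : HasDerivAt p (deriv p z) z :=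
    ((hp z hz).differentiableAt (hV.mem_nhds hz)).hasDerivAt
  have hpc : Tendsto p (𝓝 z) (𝓝 (φ (w z))) := by
    rw [hw z hz]; exact hpz.continuousAt
  -- The preimages `w` were chosen pointwise; injectivity forces them to agree with the local
  -- inverse, hence to be holomorphic.
  have heq : w =ᶠ[𝓝 z] g ∘ p := by
    filter_upwards [hpc.eventually hright, hpc.eventually hgU, hV.mem_nhds hz] with y h1 h2 h3
    exact hinj (hwU y h3) h2 (by rw [Function.comp, h1, hw y h3])
  have hgp : DifferentiableAt ℂ g (p z) := by
    rw [← hw z hz]; exact hg.hasDerivAt.differentiableAt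
  exact ((hgp.comp z hpz.differentiableAt).congr_of_eventuallyEq heq).differentiableWithinAt

/-- The image of an open set under a holomorphic function with nonvanishing derivative is open. -/
theorem isOpen_image_of_deriv_ne_zero {φ : ℂ → ℂ} {U : Set ℂ} (hU : IsOpen U)
    (hφ : DifferentiableOn ℂ φ U) (hφ' : ∀ z ∈ U, deriv φ z ≠ 0) : IsOpen (φ '' U) := by
  rw [isOpen_iff_mem_nhds]
  rintro _ ⟨z, hz, rfl⟩
  have hstrict : HasStrictDerivAt φ (deriv φ z) z :=
    (hφ.analyticAt (hU.mem_nhds hz)).hasStrictDerivAt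
  rw [← hstrict.map_nhds_eq (hφ' z hz)]
  exact image_mem_map (hU.mem_nhds hz)

theorem mem_unitDisk {z : ℂ} : z ∈ unitDisk ↔ ‖z‖ < 1 := by simp [unitDisk]

theorem isOpen_unitDisk : IsOpen unitDisk := isOpen_ball

/-- A function which starts in `φ '' unitDisk` and avoids the values of `φ` on the unit circle is
subordinate to `φ`. -/
theorem subordinate_of_avoid {φ p : ℂ → ℂ} (hφ : DifferentiableOn ℂ φ unitDisk)
    (hφ' : ∀ z ∈ unitDisk, deriv φ z ≠ 0) (hc : ContinuousOn φ (closedBall 0 1))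
    (hinj : Set.InjOn φ unitDisk) (hp : DifferentiableOn ℂ p unitDisk) (h0 : p 0 = φ 0)
    (havoid : ∀ z ∈ unitDisk, ∀ ζ : ℂ, ‖ζ‖ = 1 → p z ≠ φ ζ) : Subordinate p φ := by
  have h0mem : (0 : ℂ) ∈ unitDisk := by simp [unitDisk]
  have hopen := isOpen_image_of_deriv_ne_zero isOpen_unitDisk hφ hφ'
  have hclosed : IsClosed (φ '' closedBall 0 1) :=
    ((isCompact_closedBall 0 1).image_of_continuousOn hc).isClosed
  have hmaps : ∀ z ∈ unitDisk, p z ∈ φ '' unitDisk := by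
    have hpre : IsPreconnected (p '' unitDisk) :=
      (convex_ball (0 : ℂ) 1).isPreconnected.image p hp.continuousOn
    have hsub : p '' unitDisk ⊆ φ '' unitDisk := by
      -- The connected set `p(𝔻)` misses the boundary curve, so it is covered by two disjoint open
      -- sets: `φ(𝔻)` and the complement of the image of the closed disk.
      refine hpre.subset_left_of_subset_union hopen hclosed.isOpen_compl ?_ ?_
        ⟨p 0, ⟨0, h0mem, rfl⟩, 0, h0mem, h0.symm⟩
      · refine Set.disjoint_left.2 ?_
        rintro _ ⟨a, ha, rfl⟩ hn
        exact hn ⟨a, ball_subset_closedBall ha, rfl⟩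
      · rintro _ ⟨z, hz, rfl⟩
        by_cases h : p z ∈ φ '' closedBall 0 1
        · obtain ⟨a, ha, hpa⟩ := h
          rw [mem_closedBall_zero_iff] at ha
          rcases ha.lt_or_eq with h1 | h1
          · exact Or.inl ⟨a, mem_unitDisk.2 h1, hpa⟩
          · exact absurd hpa.symm (havoid z hz a h1)
        · exact Or.inr h
    exact fun z hz => hsub ⟨z, hz, rfl⟩
  obtain ⟨w, hwd, hw⟩ := exists_holomorphic_lift isOpen_unitDisk isOpen_unitDisk hφ hφ' hinj hp hmaps
  refine ⟨w, hwd, ?_, fun z hz => mem_unitDisk.1 (hw z hz).1, fun z hz => (hw z hz).2.symm⟩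
  exact hinj (hw 0 h0mem).1 h0mem ((hw 0 h0mem).2.trans h0)

/-! ### The nephroid and its primitive -/

/-- The primitive of `(φ_Ne(z) - 1) / z`. -/
noncomputable def nephroidPrimitive (z : ℂ) : ℂ := z - z ^ 3 / 9

theorem hasDerivAt_nephroidPrimitive (z : ℂ) :
    HasDerivAt nephroidPrimitive (1 - z ^ 2 / 3) z := by
  have := (hasDerivAt_id z).sub ((hasDerivAt_pow 3 z).div_const 9)
  refine HasDerivAt.congr_deriv (f := nephroidPrimitive) this ?_
  push_cast; ring

theorem differentiable_nephroidPrimitive : Differentiable ℂ nephroidPrimitive :=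
  fun z => (hasDerivAt_nephroidPrimitive z).differentiableAt

theorem deriv_nephroidPrimitive_ne_zero {z : ℂ} (hz : z ∈ ball (0 : ℂ) (3 / 2)) :
    deriv nephroidPrimitive z ≠ 0 := by
  rw [(hasDerivAt_nephroidPrimitive z).deriv]
  intro h
  rw [mem_ball_zero_iff] at hz
  have h3 : z ^ 2 = 3 := by linear_combination (-3) * h
  have := congrArg norm h3
  rw [norm_pow, Complex.norm_ofNat] at this
  nlinarith [norm_nonneg z]

/-- Two points with equal values satisfy `a² + ab + b² = 9`, impossible when both moduli are below
`3/2`. A radius above `1` is needed so that lifts exist up to and across the unit circle. -/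
theorem injOn_nephroidPrimitive : Set.InjOn nephroidPrimitive (ball (0 : ℂ) (3 / 2)) := by
  intro a ha b hb hab
  rw [mem_ball_zero_iff] at ha hb
  by_contra hne
  have h9 : a ^ 2 + a * b + b ^ 2 = 9 := by
    have : (a - b) * (a ^ 2 + a * b + b ^ 2 - 9) = 0 := by
      simp only [nephroidPrimitive] at hab
      linear_combination (-9) * hab
    rcases mul_eq_zero.1 this with h | h
    · exact absurd (sub_eq_zero.1 h) hne
    · linear_combination h
  have h1 : ‖a ^ 2 + a * b + b ^ 2‖ ≤ ‖a‖ ^ 2 + ‖a‖ * ‖b‖ + ‖b‖ ^ 2 := by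
    refine (norm_add₃_le).trans ?_
    simp [norm_pow]
  rw [h9, Complex.norm_ofNat] at h1
  nlinarith [norm_nonneg a, norm_nonneg b]

theorem sub_cube_div_three_eq (x y : ℝ) : (⟨x, y⟩ : ℂ) - ⟨x, y⟩ ^ 3 / 3 =
    ⟨x - (x ^ 3 - 3 * x * y ^ 2) / 3, y - (3 * x ^ 2 * y - y ^ 3) / 3⟩ := by
  have e : (⟨x, y⟩ : ℂ) ^ 3 = ⟨x ^ 3 - 3 * x * y ^ 2, 3 * x ^ 2 * y - y ^ 3⟩ := by
    apply Complex.ext <;> simp [pow_succ] <;> ring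
  rw [e]
  apply Complex.ext <;> simp

/-- The values of `z - z³/3` on the unit disk lie inside the nephroid. -/
theorem nephroid_interior {w : ℂ} (hw : ‖w‖ < 1) :
    (Complex.normSq (w - w ^ 3 / 3) - 4 / 9) ^ 3 < 4 / 3 * (w - w ^ 3 / 3).im ^ 2 := by
  obtain ⟨a, b⟩ := w
  have hw2 : a ^ 2 + b ^ 2 < 1 := by
    have := Complex.sq_norm (⟨a, b⟩ : ℂ)
    rw [Complex.normSq_mk] at this
    nlinarith [norm_nonneg (⟨a, b⟩ : ℂ)]
  rw [sub_cube_div_three_eq, Complex.normSq_mk]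
  obtain ⟨n, hn⟩ : ∃ n, n = a ^ 2 + b ^ 2 := ⟨_, rfl⟩
  obtain ⟨C, hC⟩ : ∃ C, C = 4 * b ^ 2 / 3 := ⟨_, rfl⟩
  have hn0 : 0 ≤ n := by rw [hn]; positivity
  have hC0 : 0 ≤ C := by rw [hC]; positivity
  have hn1 : n < 1 := hn ▸ hw2
  -- With `n = |w|²` and `C = 4 (Im w)²/3`, the left base is `|w - w³/3|² - 4/9`, and `4/3` times
  -- the squared imaginary part of `w - w³/3` is `C (1 - n + C)²`.
  have hlt : (n * C - (1 - n) ^ 2 * (4 - n) / 9) ^ 3 < (n * C) ^ 3 := by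
    apply Odd.strictMono_pow (by decide : Odd 3)
    have : 0 < (1 - n) ^ 2 * (4 - n) / 9 := by
      have : 0 < 1 - n := by linarith
      have : 0 < 4 - n := by linarith
      positivity
    linarith
  have h2 : (n * C) ^ 3 ≤ C * (1 - n + C) ^ 2 := by
    have h3 : n ^ 3 ≤ 1 := pow_le_one₀ hn0 hn1.le
    have h5 : C ^ 2 ≤ (1 - n + C) ^ 2 := pow_le_pow_left₀ hC0 (by linarith) 2
    calc (n * C) ^ 3 = n ^ 3 * C ^ 3 := by ring
      _ ≤ 1 * C ^ 3 := mul_le_mul_of_nonneg_right h3 (by positivity)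
      _ = C * C ^ 2 := by ring
      _ ≤ _ := mul_le_mul_of_nonneg_left h5 hC0
  refine lt_of_eq_of_lt ?_ (hlt.trans_le (h2.trans_eq ?_))
  · rw [hC, hn]; ring
  · rw [hC, hn]; ring

/-- The nephroid region is starlike: real multiples `m ≥ 1` of boundary values of `z - z³/3` are
not interior values. -/
theorem nephroid_ne_mul {u w : ℂ} {m : ℝ} (hu : ‖u‖ = 1) (hm : 1 ≤ m) (hw : ‖w‖ < 1) :
    w - w ^ 3 / 3 ≠ m * (u - u ^ 3 / 3) := by
  intro h
  have hint := nephroid_interior hw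
  rw [h] at hint
  obtain ⟨c, s⟩ := u
  have hu2 : c ^ 2 = 1 - s ^ 2 := by
    have := Complex.sq_norm (⟨c, s⟩ : ℂ)
    rw [hu, Complex.normSq_mk] at this; linarith
  rw [Complex.normSq_mul, Complex.normSq_ofReal, Complex.im_ofReal_mul, sub_cube_div_three_eq,
    Complex.normSq_mk] at hint
  have hs : (c - (c ^ 3 - 3 * c * s ^ 2) / 3) * (c - (c ^ 3 - 3 * c * s ^ 2) / 3)
      + (s - (3 * c ^ 2 * s - s ^ 3) / 3) * (s - (3 * c ^ 2 * s - s ^ 3) / 3)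
      = 4 / 9 + 4 / 3 * s ^ 2 := by
    have : c * c * (1 - (c ^ 2 - 3 * s ^ 2) / 3) ^ 2
        + (s - (3 * c ^ 2 * s - s ^ 3) / 3) * (s - (3 * c ^ 2 * s - s ^ 3) / 3)
        = 4 / 9 + 4 / 3 * s ^ 2 := by
      rw [← pow_two, hu2]; ring
    rw [← this]; ring
  have hs2 : s - (3 * c ^ 2 * s - s ^ 3) / 3 = 4 / 3 * s ^ 3 := by rw [hu2]; ring
  rw [hs, hs2] at hint
  -- On the unit circle both sides of the nephroid equation equal `S³`. Scaling by `m` multiplies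
  -- the right side by `m²`, but the left side by at least `m⁶`.
  obtain ⟨S, hS⟩ : ∃ S, S = 4 / 3 * s ^ 2 := ⟨_, rfl⟩
  have hS0 : 0 ≤ S := by rw [hS]; positivity
  have hm2 : 1 ≤ m * m := by nlinarith
  have hE1 : m * m * S ≤ m * m * (4 / 9 + 4 / 3 * s ^ 2) - 4 / 9 := by rw [← hS]; nlinarith
  have hcube := pow_le_pow_left₀ (by positivity) hE1 3
  have h1 : m * m * S ^ 3 ≤ (m * m * S) ^ 3 := by
    have h6 : m * m ≤ (m * m) ^ 3 := le_self_pow₀ hm2 (by norm_num)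
    calc m * m * S ^ 3 ≤ (m * m) ^ 3 * S ^ 3 := mul_le_mul_of_nonneg_right h6 (by positivity)
      _ = _ := by ring
  have h2 : 4 / 3 * (m * (4 / 3 * s ^ 3)) ^ 2 = m * m * S ^ 3 := by rw [hS]; ring
  linarith

/-! ### Jack's lemma and the range of `F` -/

/-- Jack's lemma. -/
theorem exists_mul_deriv_eq_of_norm_le {u : ℂ → ℂ} {z₀ : ℂ} (hz₀ : z₀ ≠ 0)
    (hu : DifferentiableAt ℂ u z₀) (hle : ∀ z, ‖z‖ ≤ ‖z₀‖ → ‖u z‖ ≤ ‖z‖ / ‖z₀‖)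
    (hu₀ : ‖u z₀‖ = 1) : ∃ m : ℝ, 1 ≤ m ∧ z₀ * deriv u z₀ = m * u z₀ := by
  have hr : 0 < ‖z₀‖ := norm_pos_iff.2 hz₀
  set a := z₀ * deriv u z₀ with ha
  have hrad : HasDerivAt (fun t : ℝ => ‖u (t * z₀)‖ ^ 2) (2 * inner ℝ (u z₀) a) 1 := by
    have h1 : HasDerivAt (fun t : ℝ => (t : ℂ) * z₀) z₀ 1 := by
      simpa using (Complex.ofRealCLM.hasDerivAt (x := (1 : ℝ))).mul_const z₀
    have h2 : HasDerivAt u (deriv u z₀) (((1 : ℝ) : ℂ) * z₀) := by simpa using hu.hasDerivAt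
    have h3 := (h2.comp (1 : ℝ) h1).norm_sq
    simpa [Function.comp_def, ha, mul_comm] using h3
  have htan : HasDerivAt (fun θ : ℝ => ‖u (Complex.exp (θ * Complex.I) * z₀)‖ ^ 2)
      (2 * inner ℝ (u z₀) (Complex.I * a)) 0 := by
    have h1 : HasDerivAt (fun θ : ℝ => Complex.exp (θ * Complex.I) * z₀) (Complex.I * z₀) 0 := by
      have := (((Complex.ofRealCLM.hasDerivAt (x := (0 : ℝ))).mul_const Complex.I).cexp).mul_const z₀
      simpa using this
    have h2 : HasDerivAt u (deriv u z₀) (Complex.exp ((0 : ℝ) * Complex.I) * z₀) := by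
      simpa using hu.hasDerivAt
    have h3 := (h2.comp (0 : ℝ) h1).norm_sq
    have e : deriv u z₀ * (Complex.I * z₀) = Complex.I * a := by rw [ha]; ring
    simpa [Function.comp_def, e] using h3
  have him : inner ℝ (u z₀) (Complex.I * a) = 0 := by
    have hmax : IsLocalMax (fun θ : ℝ => ‖u (Complex.exp (θ * Complex.I) * z₀)‖ ^ 2) 0 := by
      refine Eventually.of_forall fun θ => ?_
      have hn : ‖Complex.exp (θ * Complex.I) * z₀‖ = ‖z₀‖ := by
        rw [norm_mul, Complex.norm_exp_ofReal_mul_I, one_mul]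
      have := hle _ hn.le
      rw [hn, div_self hr.ne'] at this
      simpa [hu₀] using this
    have := hmax.hasDerivAt_eq_zero htan
    linarith
  have hre : 1 ≤ inner ℝ (u z₀) a := by
    have hd : HasDerivAt (fun t : ℝ => ‖u (t * z₀)‖ ^ 2 - t ^ 2)
        (2 * inner ℝ (u z₀) a - 2) 1 := by
      refine HasDerivAt.congr_deriv (f := fun t : ℝ => ‖u (t * z₀)‖ ^ 2 - t ^ 2)
        (hrad.sub (hasDerivAt_pow 2 (1 : ℝ))) ?_
      norm_num
    -- The tangential derivative made `z₀ u'(z₀) / u(z₀)` real. This one-sided maximum along the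
    -- radius, with value `0` at `t = 1`, bounds it below by `1`.
    have hmax : IsMaxOn (fun t : ℝ => ‖u (t * z₀)‖ ^ 2 - t ^ 2) (Set.Icc 0 1) 1 := by
      intro t ht
      have hn : ‖(t : ℂ) * z₀‖ = t * ‖z₀‖ := by
        rw [norm_mul, Complex.norm_real, Real.norm_of_nonneg ht.1]
      have := hle (t * z₀) (by rw [hn]; nlinarith [ht.2])
      rw [hn, mul_div_assoc, div_self hr.ne', mul_one] at this
      have h2 := pow_le_pow_left₀ (norm_nonneg _) this 2
      simp only [Complex.ofReal_one, one_mul, hu₀, Set.mem_ofPred_eq]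
      linarith
    have hcone : (-1 : ℝ) ∈ posTangentConeAt (Set.Icc (0 : ℝ) 1) 1 := by
      refine mem_posTangentConeAt_of_segment_subset ?_
      rw [segment_symm, segment_eq_Icc (by norm_num)]
      norm_num
    have := hmax.localize.hasFDerivWithinAt_nonpos hd.hasFDerivAt.hasFDerivWithinAt hcone
    rw [ContinuousLinearMap.toSpanSingleton_apply, smul_eq_mul] at this
    linarith
  refine ⟨inner ℝ (u z₀) a, hre, ?_⟩
  rw [Complex.inner] at him hre ⊢
  have hns : (u z₀).re ^ 2 + (u z₀).im ^ 2 = 1 := by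
    have := Complex.sq_norm (u z₀)
    rw [hu₀, Complex.normSq_apply] at this; linarith
  simp only [Complex.mul_re, Complex.mul_im, Complex.conj_re, Complex.conj_im, Complex.I_re,
    Complex.I_im] at him
  apply Complex.ext
  · simp
    linear_combination (-a.re) * hns + (u z₀).im * him
  · simp
    linear_combination (-a.im) * hns - (u z₀).re * him

/-- Suffridge's theorem for the nephroid: if `z F'(z)` takes values in the nephroid, then `F` takes
values in the image of its (convex) primitive. -/
theorem mem_image_nephroidPrimitive {F w : ℂ → ℂ} (hF : DifferentiableOn ℂ F unitDisk)
    (h0 : F 0 = 0) (hw : ∀ z ∈ unitDisk, ‖w z‖ < 1)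
    (hFw : ∀ z ∈ unitDisk, z * deriv F z = w z - w z ^ 3 / 3) :
    ∀ z ∈ unitDisk, F z ∈ nephroidPrimitive '' unitDisk := by
  by_contra! hcon
  obtain ⟨z₁, hz₁, hbad₁⟩ := hcon
  set H := nephroidPrimitive with hH
  have hz₁' := mem_unitDisk.1 hz₁
  have hsubD : closedBall (0 : ℂ) ‖z₁‖ ⊆ unitDisk := fun z hz =>
    mem_unitDisk.2 ((mem_closedBall_zero_iff.1 hz).trans_lt hz₁')
  have hsubU : closedBall (0 : ℂ) 1 ⊆ ball 0 (3 / 2) := closedBall_subset_ball (by norm_num)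
  have hsubU' : unitDisk ⊆ ball (0 : ℂ) (3 / 2) := ball_subset_closedBall.trans hsubU
  have hopen : IsOpen (H '' unitDisk) := isOpen_image_of_deriv_ne_zero isOpen_unitDisk
    differentiable_nephroidPrimitive.differentiableOn
    fun z hz => deriv_nephroidPrimitive_ne_zero (hsubU' hz)
  have hclosed : IsClosed (H '' closedBall 0 1) :=
    ((isCompact_closedBall 0 1).image differentiable_nephroidPrimitive.continuous).isClosed
  have hcomp : IsCompact (closedBall (0 : ℂ) ‖z₁‖ ∩ F ⁻¹' (H '' unitDisk)ᶜ) :=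
    (isCompact_closedBall (0 : ℂ) ‖z₁‖).of_isClosed_subset
      ((hF.continuousOn.mono hsubD).preimage_isClosed_of_isClosed isClosed_closedBall
        hopen.isClosed_compl) Set.inter_subset_left
  -- A point of least modulus at which `F` is outside `H(𝔻)`.
  obtain ⟨z₀, ⟨hz₀m, hz₀bad⟩, hmin⟩ := hcomp.exists_isMinOn
    ⟨z₁, mem_closedBall_zero_iff.2 le_rfl, hbad₁⟩ continuous_norm.continuousOn
  have hz₀1 : ‖z₀‖ ≤ ‖z₁‖ := mem_closedBall_zero_iff.1 hz₀m
  have hz₀D : z₀ ∈ unitDisk := hsubD hz₀m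
  have h0D : (0 : ℂ) ∈ unitDisk := by simp [unitDisk]
  have hH0 : H 0 = 0 := by simp [hH, nephroidPrimitive]
  have hz₀ : z₀ ≠ 0 := by
    rintro rfl
    exact hz₀bad ⟨0, h0D, by rw [hH0, h0]⟩
  have hr : 0 < ‖z₀‖ := norm_pos_iff.2 hz₀
  have hin : ∀ z ∈ ball (0 : ℂ) ‖z₀‖, F z ∈ H '' unitDisk := by
    intro z hz
    rw [mem_ball_zero_iff] at hz
    by_contra hb
    have : ‖z₀‖ ≤ ‖z‖ := hmin ⟨mem_closedBall_zero_iff.2 (hz.le.trans hz₀1), hb⟩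
    linarith
  have hsub₀ : closedBall (0 : ℂ) ‖z₀‖ ⊆ unitDisk :=
    (closedBall_subset_closedBall hz₀1).trans hsubD
  have hcl : ∀ z ∈ closedBall (0 : ℂ) ‖z₀‖, F z ∈ H '' closedBall 0 1 := by
    have hm : Set.MapsTo F (ball 0 ‖z₀‖) (H '' closedBall 0 1) := fun z hz =>
      Set.image_mono ball_subset_closedBall (hin z hz)
    have hm' := hm.closure_of_continuousOn
      (by rw [closure_ball _ hr.ne']; exact hF.continuousOn.mono hsub₀)
    rw [closure_ball _ hr.ne', hclosed.closure_eq] at hm'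
    exact hm'
  have hopen2 : IsOpen (H '' ball 0 (3 / 2)) := isOpen_image_of_deriv_ne_zero isOpen_ball
    differentiable_nephroidPrimitive.differentiableOn
    fun z hz => deriv_nephroidPrimitive_ne_zero hz
  have hV : IsOpen (unitDisk ∩ F ⁻¹' (H '' ball 0 (3 / 2))) :=
    hF.continuousOn.isOpen_inter_preimage isOpen_unitDisk hopen2
  obtain ⟨u, hud, hu⟩ := exists_holomorphic_lift isOpen_ball hV
    differentiable_nephroidPrimitive.differentiableOn
    (fun z hz => deriv_nephroidPrimitive_ne_zero hz) injOn_nephroidPrimitive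
    (hF.mono Set.inter_subset_left) (fun z hz => hz.2)
  have hclV : closedBall (0 : ℂ) ‖z₀‖ ⊆ unitDisk ∩ F ⁻¹' (H '' ball 0 (3 / 2)) := fun z hz =>
    ⟨hsub₀ hz, Set.image_mono hsubU (hcl z hz)⟩
  have hz₀V := hclV (mem_closedBall_zero_iff.2 le_rfl)
  have hu1 : ∀ z ∈ closedBall (0 : ℂ) ‖z₀‖, ‖u z‖ ≤ 1 := by
    intro z hz
    obtain ⟨a, ha, haF⟩ := hcl z hz
    have : u z = a := injOn_nephroidPrimitive (hu z (hclV hz)).1 (hsubU ha)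
      ((hu z (hclV hz)).2.trans haF.symm)
    rw [this]; exact mem_closedBall_zero_iff.1 ha
  have hu₀ : ‖u z₀‖ = 1 := by
    refine le_antisymm (hu1 z₀ (mem_closedBall_zero_iff.2 le_rfl)) ?_
    by_contra hlt
    exact hz₀bad ⟨u z₀, mem_unitDisk.2 (not_le.1 hlt), (hu z₀ hz₀V).2⟩
  have h0V := hclV (mem_closedBall_self hr.le)
  have hu0 : u 0 = 0 := injOn_nephroidPrimitive (hu 0 h0V).1 (mem_ball_self (by norm_num))
    ((hu 0 h0V).2.trans (h0.trans hH0.symm))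
  -- Schwarz's lemma inside the disk of radius `|z₀|`, and the bound `1` on its boundary.
  have hle : ∀ z, ‖z‖ ≤ ‖z₀‖ → ‖u z‖ ≤ ‖z‖ / ‖z₀‖ := by
    intro z hz
    rcases hz.lt_or_eq with h | h
    · have := Complex.dist_le_div_mul_dist_of_mapsTo_ball (f := u) (c := 0) (R₁ := ‖z₀‖) (R₂ := 1)
        (z := z) (hud.mono (ball_subset_closedBall.trans hclV))
        (fun y hy => by
          rw [hu0, mem_closedBall_zero_iff]
          exact hu1 y (ball_subset_closedBall hy)) (mem_ball_zero_iff.2 h)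
      rw [hu0, dist_zero_right, dist_zero_right] at this
      calc ‖u z‖ ≤ 1 / ‖z₀‖ * ‖z‖ := this
        _ = _ := by ring
    · rw [h, div_self hr.ne']
      exact hu1 z (mem_closedBall_zero_iff.2 hz)
  have hudz : DifferentiableAt ℂ u z₀ := (hud z₀ hz₀V).differentiableAt (hV.mem_nhds hz₀V)
  obtain ⟨m, hm, hmu⟩ := exists_mul_deriv_eq_of_norm_le hz₀ hudz hle hu₀
  have hFd : deriv F z₀ = (1 - u z₀ ^ 2 / 3) * deriv u z₀ := by
    have heq : F =ᶠ[𝓝 z₀] H ∘ u := by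
      filter_upwards [hV.mem_nhds hz₀V] with z hz using (hu z hz).2.symm
    rw [heq.deriv_eq]
    exact ((hasDerivAt_nephroidPrimitive _).comp z₀ hudz.hasDerivAt).deriv
  -- Here `z₀ F'(z₀) = z₀ u'(z₀) H'(u) = m u (1 - u²/3) = m (u - u³/3)` with `u = u(z₀)`.
  refine nephroid_ne_mul hu₀ hm (hw z₀ hz₀D) ?_
  rw [← hFw z₀ hz₀D, hFd]
  linear_combination (1 - u z₀ ^ 2 / 3) * hmu

/-! ### An explicit region containing `H(𝔻)`, and points outside it -/

/-- An implicit description of the image of the unit disk under `z - z³/9`. -/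
def nephroidPrimitiveRegion : Set ℂ :=
  {v | Complex.normSq v < 64 / 81 ∨ (Complex.normSq v - 64 / 81) *
    (1 + 3 / 2 * (Complex.normSq v - 64 / 81)) ^ 2 < v.im ^ 2}

theorem notMem_nephroidPrimitiveRegion {v : ℂ} : v ∉ nephroidPrimitiveRegion ↔
    64 / 81 ≤ Complex.normSq v ∧ v.im ^ 2 ≤ (Complex.normSq v - 64 / 81) *
      (1 + 3 / 2 * (Complex.normSq v - 64 / 81)) ^ 2 := by
  simp [nephroidPrimitiveRegion]

/-- Let `D = |v|² - 64/81` for `v = H(w)`. If `|w| = 1`, then `D = 4/9 (Im w)²` and `(Im v)² = D (1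
+ 3D/2)²`. For `|w| < 1`, `D` falls below `4/9 (Im w)²` and `(Im v)²` does not fall below its value
for that `D`; monotonicity of `t (1 + 3t/2)²` for `t ≥ 0` finishes. Only this inclusion is needed,
not equality. -/
theorem image_nephroidPrimitive_subset :
    nephroidPrimitive '' unitDisk ⊆ nephroidPrimitiveRegion := by
  rintro _ ⟨⟨a, b⟩, hw, rfl⟩
  rw [mem_unitDisk] at hw
  have hw2 : a ^ 2 + b ^ 2 < 1 := by
    have := Complex.sq_norm (⟨a, b⟩ : ℂ)
    rw [Complex.normSq_mk] at this
    nlinarith [norm_nonneg (⟨a, b⟩ : ℂ)]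
  have e : nephroidPrimitive ⟨a, b⟩ =
      ⟨a - (a ^ 3 - 3 * a * b ^ 2) / 9, b - (3 * a ^ 2 * b - b ^ 3) / 9⟩ := by
    have e3 : (⟨a, b⟩ : ℂ) ^ 3 = ⟨a ^ 3 - 3 * a * b ^ 2, 3 * a ^ 2 * b - b ^ 3⟩ := by
      apply Complex.ext <;> simp [pow_succ] <;> ring
    rw [nephroidPrimitive, e3]
    apply Complex.ext <;> simp
  by_contra hnot
  rw [notMem_nephroidPrimitiveRegion, e, Complex.normSq_mk] at hnot
  obtain ⟨n, hn⟩ : ∃ n, n = a ^ 2 + b ^ 2 := ⟨_, rfl⟩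
  obtain ⟨B, hB⟩ : ∃ B, B = b ^ 2 := ⟨_, rfl⟩
  have hn0 : 0 ≤ n := by rw [hn]; positivity
  have hB0 : 0 ≤ B := by rw [hB]; positivity
  have hn1 : n < 1 := hn ▸ hw2
  obtain ⟨D, hD⟩ : ∃ D, D = (n - 1) * (n ^ 2 - 17 * n + 64) / 81 + 4 / 9 * n * B := ⟨_, rfl⟩
  have e1 : (a - (a ^ 3 - 3 * a * b ^ 2) / 9) * (a - (a ^ 3 - 3 * a * b ^ 2) / 9) +
      (b - (3 * a ^ 2 * b - b ^ 3) / 9) * (b - (3 * a ^ 2 * b - b ^ 3) / 9) = D + 64 / 81 := by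
    rw [hD, hn, hB]; ring
  have e2 : (b - (3 * a ^ 2 * b - b ^ 3) / 9) ^ 2 = B * (1 - n / 3 + 4 / 9 * B) ^ 2 := by
    rw [hn, hB]; ring
  rw [e1, show Complex.im ⟨a - (a ^ 3 - 3 * a * b ^ 2) / 9, b - (3 * a ^ 2 * b - b ^ 3) / 9⟩ =
    b - (3 * a ^ 2 * b - b ^ 3) / 9 from rfl, e2, add_sub_cancel_right] at hnot
  obtain ⟨hD0, hle⟩ := hnot
  have hD0 : 0 ≤ D := by linarith
  have hDlt : D < 4 / 9 * B := by
    have h1 : 0 < (1 - n) * (n ^ 2 - 17 * n + 64) := by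
      apply mul_pos <;> nlinarith
    have h2 : 0 ≤ (1 - n) * B := mul_nonneg (by linarith) hB0
    rw [hD]; linarith
  have h3 : D * (1 + 3 / 2 * D) ^ 2 < 4 / 9 * B * (1 + 3 / 2 * (4 / 9 * B)) ^ 2 := by
    refine mul_lt_mul hDlt (pow_le_pow_left₀ (by positivity) (by linarith) 2)
      (by positivity) (by positivity)
  have h4 : 4 / 9 * B * (1 + 3 / 2 * (4 / 9 * B)) ^ 2 ≤ B * (1 - n / 3 + 4 / 9 * B) ^ 2 := by
    calc 4 / 9 * B * (1 + 3 / 2 * (4 / 9 * B)) ^ 2 = B * (2 / 3 + 4 / 9 * B) ^ 2 := by ring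
      _ ≤ _ := mul_le_mul_of_nonneg_left
        (pow_le_pow_left₀ (by positivity) (by linarith) 2) hB0
  linarith

/-- Here `|v|² - 64/81 ≥ (Im v)²`, and the squared factor is at least `1`. The number `8/9` is
`H(1)`. -/
theorem notMem_region_of_sq_re {v : ℂ} (h : 64 / 81 ≤ v.re ^ 2) :
    v ∉ nephroidPrimitiveRegion := by
  rw [notMem_nephroidPrimitiveRegion, Complex.normSq_apply]
  have hD : v.im ^ 2 ≤ v.re * v.re + v.im * v.im - 64 / 81 := by nlinarith
  have h0 : 0 ≤ v.re * v.re + v.im * v.im - 64 / 81 := (sq_nonneg _).trans hD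
  refine ⟨by linarith, hD.trans (le_mul_of_one_le_right h0 (one_le_pow₀ (by linarith)))⟩

theorem notMem_region_of_le_re {v : ℂ} (h : 8 / 9 ≤ v.re) : v ∉ nephroidPrimitiveRegion :=
  notMem_region_of_sq_re (by nlinarith)

/-- The radius `10/9` is `|H(±i)|`, the largest modulus of `H` on the closed disk. -/
theorem notMem_region_of_normSq {v : ℂ} (h : 100 / 81 ≤ Complex.normSq v) :
    v ∉ nephroidPrimitiveRegion := by
  rw [notMem_nephroidPrimitiveRegion]
  have him : v.im ^ 2 ≤ Complex.normSq v := by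
    rw [Complex.normSq_apply]; nlinarith [mul_self_nonneg v.re]
  obtain ⟨D, hD⟩ : ∃ D, D = Complex.normSq v - 64 / 81 := ⟨_, rfl⟩
  rw [← hD]
  have hD1 : 4 / 9 ≤ D := by linarith
  refine ⟨by linarith, ?_⟩
  have : (1 + 3 / 2 * (4 / 9 : ℝ)) ^ 2 ≤ (1 + 3 / 2 * D) ^ 2 :=
    pow_le_pow_left₀ (by norm_num) (by linarith) 2
  nlinarith

/-- Starlikeness of the region, which passes from the bound `b` to every `β ≥ b`. -/
theorem notMem_region_mul {v : ℂ} (h : v ∉ nephroidPrimitiveRegion) {m : ℝ} (hm : 1 ≤ m) :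
    (m : ℂ) * v ∉ nephroidPrimitiveRegion := by
  rw [notMem_nephroidPrimitiveRegion] at h ⊢
  rw [Complex.normSq_mul, Complex.normSq_ofReal, Complex.im_ofReal_mul]
  obtain ⟨h1, h2⟩ := h
  have hm2 : 1 ≤ m * m := by nlinarith
  obtain ⟨D, hD⟩ : ∃ D, D = Complex.normSq v - 64 / 81 := ⟨_, rfl⟩
  rw [← hD] at h2
  have hD0 : 0 ≤ D := by linarith
  have hD1 : m * m * D ≤ m * m * Complex.normSq v - 64 / 81 := by rw [hD]; nlinarith
  have hD2 : D ≤ m * m * D := le_mul_of_one_le_left hD0 hm2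
  refine ⟨by linarith [mul_nonneg (zero_le_one.trans hm2) hD0], ?_⟩
  calc (m * v.im) ^ 2 = m * m * v.im ^ 2 := by ring
    _ ≤ m * m * (D * (1 + 3 / 2 * D) ^ 2) := mul_le_mul_of_nonneg_left h2 (by positivity)
    _ = (m * m * D) * (1 + 3 / 2 * D) ^ 2 := by ring
    _ ≤ _ := mul_le_mul hD1 (pow_le_pow_left₀ (by positivity) (by linarith) 2)
      (by positivity) (by linarith [mul_nonneg (zero_le_one.trans hm2) hD0])

/-! ### The general criterion: validity and sharpness -/

/-- Local form of a holomorphic function at a zero, and of its derivative. -/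
theorem exists_local_factor {f : ℂ → ℂ} (hf : DifferentiableOn ℂ f unitDisk) {z₀ z₁ : ℂ}
    (hz₀ : z₀ ∈ unitDisk) (h0 : f z₀ = 0) (hz₁ : z₁ ∈ unitDisk) (h1 : f z₁ ≠ 0) :
    ∃ (m : ℕ) (g : ℂ → ℂ), AnalyticAt ℂ g z₀ ∧ g z₀ ≠ 0 ∧
      ∀ᶠ z in 𝓝 z₀, f z = (z - z₀) ^ (m + 1) * g z ∧
        deriv f z = (z - z₀) ^ m * ((m + 1) * g z + (z - z₀) * deriv g z) := by
  have han : AnalyticOnNhd ℂ f unitDisk := hf.analyticOnNhd isOpen_unitDisk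
  have hne : ¬ ∀ᶠ z in 𝓝 z₀, f z = 0 := fun h =>
    h1 (han.eqOn_zero_of_preconnected_of_eventuallyEq_zero
      (convex_ball (0 : ℂ) 1).isPreconnected hz₀ h hz₁)
  obtain ⟨n, g, hg, hg0, hfg⟩ := (han z₀ hz₀).exists_eventuallyEq_pow_smul_nonzero_iff.2 hne
  obtain _ | m := n
  · have := hfg.self_of_nhds
    simp [h0, hg0.symm] at this
  · refine ⟨m, g, hg, hg0, ?_⟩
    filter_upwards [hfg.eventually_nhds, hg.eventually_analyticAt] with z hz hgz
    refine ⟨by simpa using hz.self_of_nhds, ?_⟩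
    have hd : HasDerivAt (fun y => (y - z₀) ^ (m + 1) * g y)
        ((m + 1 : ℕ) * (z - z₀) ^ m * g z + (z - z₀) ^ (m + 1) * deriv g z) z := by
      refine HasDerivAt.congr_deriv (f := fun y => (y - z₀) ^ (m + 1) * g y)
        ((((hasDerivAt_id z).sub_const z₀).pow (m + 1)).mul
          hgz.differentiableAt.hasDerivAt) ?_
      simp
    have heq : f =ᶠ[𝓝 z] fun y => (y - z₀) ^ (m + 1) * g y := by
      filter_upwards [hz] with y hy using by simpa using hy
    rw [heq.deriv_eq, hd.deriv]
    push_cast; ring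

theorem tendsto_nhdsNE_eq {a b : ℂ → ℂ} {z₀ : ℂ} (ha : ContinuousAt a z₀)
    (hb : ContinuousAt b z₀) (h : ∀ᶠ z in 𝓝[≠] z₀, a z = b z) : a z₀ = b z₀ :=
  tendsto_nhds_unique_of_eventuallyEq (ha.mono_left nhdsWithin_le_nhds)
    (hb.mono_left nhdsWithin_le_nhds) h

/-- At a zero of order `m + 1` the quotient `z p'/p²` has a pole of order `m + 2`, whereas `φ_Ne ∘
w` stays bounded. The comparison is made on a punctured neighbourhood after clearing the pole, so
the value assigned to a division by zero plays no role. -/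
theorem ne_zero_of_diffExpr_subordinate {β : ℝ} (hβ : 0 < β) {p : ℂ → ℂ}
    (hp : DifferentiableOn ℂ p unitDisk) (hp0 : p 0 = 1)
    (h : Subordinate (diffExpr β p) phiNe) : ∀ z ∈ unitDisk, p z ≠ 0 := by
  intro z₀ hz₀ hpz
  obtain ⟨w, hwd, -, -, hw⟩ := h
  have hβ' : (β : ℂ) ≠ 0 := by exact_mod_cast hβ.ne'
  have hz₀0 : z₀ ≠ 0 := by rintro rfl; simp [hp0] at hpz
  obtain ⟨m, g, hg, hg0, hfac⟩ := exists_local_factor hp hz₀ hpz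
    (z₁ := 0) (by simp [unitDisk]) (by simp [hp0])
  have hwc : ContinuousAt w z₀ := (hwd z₀ hz₀).continuousWithinAt.continuousAt
    (isOpen_unitDisk.mem_nhds hz₀)
  have hgc := hg.continuousAt
  have hgc' := hg.deriv.continuousAt
  have key := tendsto_nhdsNE_eq (z₀ := z₀)
    (a := fun z => β * (z * ((m + 1) * g z + (z - z₀) * deriv g z)))
    (b := fun z => (w z - w z ^ 3 / 3) * ((z - z₀) ^ (m + 2) * g z ^ 2))
    (by fun_prop) (by fun_prop) (by
      filter_upwards [self_mem_nhdsWithin, hfac.filter_mono nhdsWithin_le_nhds,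
        (hgc.eventually_ne hg0).filter_mono nhdsWithin_le_nhds,
        mem_nhdsWithin_of_mem_nhds (isOpen_unitDisk.mem_nhds hz₀)] with z hz hfz hgz hzD
      have hz' : z - z₀ ≠ 0 := sub_ne_zero.2 hz
      have := hw z hzD
      rw [diffExpr, phiNe, hfz.1, hfz.2] at this
      have h2 : (β : ℂ) * (z * ((z - z₀) ^ m * ((m + 1) * g z + (z - z₀) * deriv g z)) /
          ((z - z₀) ^ (m + 1) * g z) ^ 2) = w z - w z ^ 3 / 3 := by
        linear_combination this
      rw [← h2]
      field_simp
      ring)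
  simp only [sub_self, zero_mul, add_zero] at key
  rw [zero_pow (by omega), zero_mul, mul_zero] at key
  have hm : (m : ℂ) + 1 ≠ 0 := by exact_mod_cast m.succ_ne_zero
  simp [hβ', hz₀0, hg0, hm] at key

theorem subordinate_of_diffExpr {φ : ℂ → ℂ} {b : ℝ} (hb : 0 < b)
    (hφ : DifferentiableOn ℂ φ unitDisk) (hφ' : ∀ z ∈ unitDisk, deriv φ z ≠ 0)
    (hc : ContinuousOn φ (closedBall 0 1)) (hinj : Set.InjOn φ unitDisk) (hφ0 : φ 0 = 1)
    (havoid : ∀ ζ : ℂ, ‖ζ‖ = 1 → φ ζ ≠ 0 → (b : ℂ) * (1 - (φ ζ)⁻¹) ∉ nephroidPrimitiveRegion)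
    {β : ℝ} (hβ : b ≤ β) {p : ℂ → ℂ} (hp : DifferentiableOn ℂ p unitDisk) (hp0 : p 0 = 1)
    (h : Subordinate (diffExpr β p) phiNe) : Subordinate p φ := by
  have hβ0 : 0 < β := hb.trans_le hβ
  have hpne := ne_zero_of_diffExpr_subordinate hβ0 hp hp0 h
  obtain ⟨w, -, -, hw1, hw⟩ := h
  have hFderiv : ∀ z ∈ unitDisk, HasDerivAt (fun z => (β : ℂ) * (1 - (p z)⁻¹))
      (β * (deriv p z / p z ^ 2)) z := by
    intro z hz
    have := (((hp z hz).differentiableAt (isOpen_unitDisk.mem_nhds hz)).hasDerivAt.inv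
      (hpne z hz)).const_sub 1 |>.const_mul (β : ℂ)
    refine this.congr_deriv ?_
    ring
  have hF := mem_image_nephroidPrimitive (F := fun z => (β : ℂ) * (1 - (p z)⁻¹)) (w := w)
    (fun z hz => (hFderiv z hz).differentiableAt.differentiableWithinAt) (by simp [hp0]) hw1
    (fun z hz => by
      rw [(hFderiv z hz).deriv]
      have := hw z hz
      rw [diffExpr, phiNe] at this
      linear_combination this)
  refine subordinate_of_avoid hφ hφ' hc hinj hp (hp0.trans hφ0.symm) fun z hz ζ hζ heq => ?_
  have h1 := image_nephroidPrimitive_subset (hF z hz)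
  simp only [heq] at h1
  refine notMem_region_mul (havoid ζ hζ (heq ▸ hpne z hz)) ((one_le_div hb).2 hβ) ?_
  convert h1 using 1
  have : (b : ℂ) ≠ 0 := by exact_mod_cast hb.ne'
  push_cast
  field_simp

/-- The real part of `H` on a disk of radius `r` is largest at `r`. This keeps `1 - H(rz)/β` free of
zeros when `H(r) < β`. -/
theorem re_nephroidPrimitive_le {r : ℝ} (hr1 : r ≤ 1) {z : ℂ} (hz : ‖z‖ ≤ r) :
    (nephroidPrimitive z).re ≤ r - r ^ 3 / 9 := by
  obtain ⟨x, y⟩ := z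
  have hr0 : 0 ≤ r := (norm_nonneg _).trans hz
  have h2 : x ^ 2 + y ^ 2 ≤ r ^ 2 := by
    have := Complex.sq_norm (⟨x, y⟩ : ℂ)
    rw [Complex.normSq_mk] at this
    nlinarith [norm_nonneg (⟨x, y⟩ : ℂ)]
  have e : (nephroidPrimitive ⟨x, y⟩).re = x - (x ^ 3 - 3 * x * y ^ 2) / 9 := by
    have e3 : (⟨x, y⟩ : ℂ) ^ 3 = ⟨x ^ 3 - 3 * x * y ^ 2, 3 * x ^ 2 * y - y ^ 3⟩ := by
      apply Complex.ext <;> simp [pow_succ] <;> ring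
    rw [nephroidPrimitive, e3]
    simp
  rw [e]
  have hrr : r ^ 2 ≤ 1 := pow_le_one₀ hr0 hr1
  rcases le_or_gt x 0 with hx | hx
  · have h3 : x - (x ^ 3 - 3 * x * y ^ 2) / 9 ≤ 0 := by
      have : x - (x ^ 3 - 3 * x * y ^ 2) / 9 = x * (1 - x ^ 2 / 9 + y ^ 2 / 3) := by ring
      rw [this]
      exact mul_nonpos_of_nonpos_of_nonneg hx (by nlinarith [sq_nonneg y])
    nlinarith [pow_nonneg hr0 3]
  · have hxr : x ≤ r := by nlinarith [sq_nonneg y]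
    have h3 : x * y ^ 2 ≤ x * (r ^ 2 - x ^ 2) := mul_le_mul_of_nonneg_left (by linarith) hx.le
    have h4 : 0 ≤ (r - x) * (1 + r ^ 2 / 3 - 4 / 9 * (r ^ 2 + r * x + x ^ 2)) :=
      mul_nonneg (by linarith) (by nlinarith)
    nlinarith

theorem exists_sub_cube_eq {r y : ℝ} (hr : 0 ≤ r) (hy : 0 < y) (hyr : y < r - r ^ 3 / 9) :
    ∃ s, 0 < s ∧ s < r ∧ s - s ^ 3 / 9 = y := by
  have hcont : ContinuousOn (fun t : ℝ => t - t ^ 3 / 9) (Set.Icc 0 r) := by fun_prop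
  obtain ⟨s, hs, hsy⟩ := intermediate_value_Ioo hr hcont (show y ∈ Set.Ioo _ _ by
    constructor
    · simpa using hy
    · exact hyr)
  exact ⟨s, hs.1, hs.2, hsy⟩

/-- For `p = 1 / (1 - H(rz)/β)` the expression `1 + β z p'/p²` is `φ_Ne(rz)`. The equation `p(z) =
φ(ε)` becomes `H(rz) = ε · 8β/(9b)`, solvable in the disk when `8β/(9b) < H(r)`, while `H(r) < β`
keeps `p` analytic. -/
theorem exists_not_subordinate {φ : ℂ → ℂ} {b ε : ℝ} (hb : 8 / 9 < b)
    (hε : ε = 1 ∨ ε = -1) (hφε : φ ε ≠ 0) (hend : (b : ℂ) * (1 - (φ ε)⁻¹) = 8 / 9 * ε)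
    (hinj : ∀ z, ‖z‖ < 1 → φ ε ≠ φ z) {β : ℝ} (hβ : 0 < β) (hβb : β < b) :
    ∃ p : ℂ → ℂ, DifferentiableOn ℂ p unitDisk ∧ p 0 = 1 ∧
      (∀ z ∈ unitDisk, p z ≠ 0) ∧ Subordinate (diffExpr β p) phiNe ∧ ¬ Subordinate p φ := by
  have hb0 : 0 < b := by linarith
  have hm0 : 0 < 8 / 9 * β / b := by positivity
  have hm1 : 8 / 9 * β / b < 8 / 9 := by rw [div_lt_iff₀ hb0]; nlinarith
  have hm2 : 8 / 9 * β / b < β := by rw [div_lt_iff₀ hb0]; nlinarith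
  -- The number `y` becomes `H(r)`; there is room because `β < b` and `8/9 < b`.
  obtain ⟨y, hy1, hy2⟩ := exists_between (lt_min hm1 hm2)
  obtain ⟨r, hr0, hr1, hry⟩ := exists_sub_cube_eq (r := 1) (y := y) zero_le_one
    (hm0.trans hy1) (by have := hy2.trans_le (min_le_left _ _); norm_num; linarith)
  obtain ⟨s, hs0, hsr, hsm⟩ := exists_sub_cube_eq hr0.le hm0 (hry ▸ hy1)
  have hyβ : y < β := hy2.trans_le (min_le_right _ _)
  have hβ' : (β : ℂ) ≠ 0 := by exact_mod_cast hβ.ne'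
  have hb' : (b : ℂ) ≠ 0 := by exact_mod_cast hb0.ne'
  have hr' : (r : ℂ) ≠ 0 := by exact_mod_cast hr0.ne'
  have hnorm : ∀ z ∈ unitDisk, ‖(r : ℂ) * z‖ ≤ r := by
    intro z hz
    rw [norm_mul, Complex.norm_real, Real.norm_of_nonneg hr0.le]
    nlinarith [mem_unitDisk.1 hz]
  set P : ℂ → ℂ := fun z => 1 - nephroidPrimitive (r * z) / β with hP
  have hPne : ∀ z ∈ unitDisk, P z ≠ 0 := by
    intro z hz h
    have h1 : nephroidPrimitive (r * z) = β := by
      rw [hP] at h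
      field_simp at h
      linear_combination -h
    have h2 := re_nephroidPrimitive_le hr1.le (hnorm z hz)
    rw [h1, Complex.ofReal_re, hry] at h2
    linarith
  have hPd : ∀ z, HasDerivAt P (-(r * (1 - (r * z) ^ 2 / 3) / β)) z := by
    intro z
    have h1 : HasDerivAt (fun z : ℂ => (r : ℂ) * z) r z := by
      simpa using (hasDerivAt_id z).const_mul (r : ℂ)
    have := (((hasDerivAt_nephroidPrimitive (r * z)).comp z h1).div_const (β : ℂ)).const_sub 1
    refine HasDerivAt.congr_deriv (f := P) this ?_
    ring
  refine ⟨fun z => (P z)⁻¹, fun z hz => ((hPd z).inv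
    (hPne z hz)).differentiableAt.differentiableWithinAt, ?_, fun z hz => inv_ne_zero (hPne z hz),
    ?_, ?_⟩
  · simp [hP, nephroidPrimitive]
  · refine ⟨fun z => r * z, by fun_prop, by simp, fun z hz => ?_, fun z hz => ?_⟩
    · exact (hnorm z hz).trans_lt hr1
    · have hd : deriv (fun z => (P z)⁻¹) z = -(-(r * (1 - (r * z) ^ 2 / 3) / β)) / P z ^ 2 :=
        ((hPd z).inv (hPne z hz)).deriv
      rw [diffExpr, hd, phiNe]
      have := hPne z hz
      field_simp
      ring
  · rintro ⟨w, -, -, hw1, hw⟩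
    have hεn : |ε| = 1 := by rcases hε with rfl | rfl <;> simp
    have hz₀ : (ε * s / r : ℂ) ∈ unitDisk := by
      rw [mem_unitDisk, norm_div, norm_mul, Complex.norm_real, Complex.norm_real,
        Complex.norm_real, Real.norm_eq_abs, hεn, Real.norm_of_nonneg hs0.le,
        Real.norm_of_nonneg hr0.le, one_mul, div_lt_one hr0]
      exact hsr
    refine hinj _ (hw1 _ hz₀) ?_
    rw [← hw _ hz₀]
    have e1 : (r : ℂ) * (ε * s / r) = ε * s := by field_simp
    have e2 : nephroidPrimitive (ε * s) = ε * (8 / 9 * β / b) := by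
      have h3 : (s : ℂ) - s ^ 3 / 9 = 8 / 9 * β / b := by
        have := congrArg Complex.ofReal hsm
        push_cast at this
        exact this
      have hε3 : (ε : ℂ) ^ 3 = ε := by rcases hε with rfl | rfl <;> norm_num
      rw [← h3, nephroidPrimitive, mul_pow, hε3]; ring
    have e3 : P (ε * s / r) = (φ ε)⁻¹ := by
      simp only [hP]
      rw [e1, e2]
      have : 1 - (φ ε)⁻¹ = 8 / 9 * ε / b := by
        rw [eq_div_iff hb', ← hend]; ring
      have e4 : (ε : ℂ) * (8 / 9 * β / b) / β = 8 / 9 * ε / b := by field_simp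
      rw [e4, ← this]; ring
    exact (by rw [e3, inv_inv] : (P (ε * s / r))⁻¹ = φ ε).symm

/-- A criterion for sharp subordination bounds. -/
theorem sharpSubordinationBound_of {φ : ℂ → ℂ} {b ε : ℝ} (hb : 8 / 9 < b)
    (hφ : ∀ z, ‖z‖ < 1 → ∃ φ', HasDerivAt φ φ' z ∧ φ' ≠ 0)
    (hc : ContinuousOn φ (closedBall 0 1))
    (hinj : ∀ x y, ‖x‖ ≤ 1 → ‖y‖ < 1 → φ x = φ y → x = y) (hφ0 : φ 0 = 1)
    (havoid : ∀ ζ : ℂ, ‖ζ‖ = 1 → φ ζ ≠ 0 → (b : ℂ) * (1 - (φ ζ)⁻¹) ∉ nephroidPrimitiveRegion)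
    (hε : ε = 1 ∨ ε = -1) (hφε : φ ε ≠ 0) (hend : (b : ℂ) * (1 - (φ ε)⁻¹) = 8 / 9 * ε) :
    SharpSubordinationBound φ b := by
  have hεn : ‖(ε : ℂ)‖ = 1 := by rcases hε with rfl | rfl <;> simp
  refine ⟨fun β hβ p hp hp0 h => ?_, fun β hβ hβb => ?_⟩
  · refine subordinate_of_diffExpr (by linarith) (fun z hz => ?_) (fun z hz => ?_) hc
      (fun x hx y hy => hinj x y (mem_unitDisk.1 hx).le (mem_unitDisk.1 hy)) hφ0 havoid hβ hp hp0 h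
    · obtain ⟨φ', h1, -⟩ := hφ z (mem_unitDisk.1 hz)
      exact h1.differentiableAt.differentiableWithinAt
    · obtain ⟨φ', h1, h2⟩ := hφ z (mem_unitDisk.1 hz)
      rwa [h1.deriv]
  · refine exists_not_subordinate hb hε hφε hend (fun z hz heq => ?_) hβ hβb
    have := hinj _ _ hεn.le hz heq
    rw [← this, hεn] at hz
    exact lt_irrefl _ hz

/-! ### From `p` to `f` through `p = z f'/f` -/

theorem ClassA.exists_eq_mul {f : ℂ → ℂ} (hf : ClassA f) :
    ∃ G : ℂ → ℂ, DifferentiableOn ℂ G unitDisk ∧ G 0 = 1 ∧ ∀ z, f z = z * G z := by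
  refine ⟨dslope f 0, (Complex.differentiableOn_dslope
    (isOpen_unitDisk.mem_nhds (by simp [unitDisk]))).2 hf.1, ?_, fun z => ?_⟩
  · rw [dslope_same, hf.2.2]
  · have := sub_smul_dslope f 0 z
    simpa [hf.2.1] using this.symm

theorem starlikeDiffExpr_eq_diffExpr (β : ℝ) {f : ℂ → ℂ} (hf : DifferentiableOn ℂ f unitDisk)
    (hne : ∀ z ∈ unitDisk, z ≠ 0 → f z ≠ 0) {z : ℂ} (hz : z ∈ unitDisk) :
    starlikeDiffExpr β f z = diffExpr β (starlikeQuot f) z := by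
  rcases eq_or_ne z 0 with rfl | hz0
  · simp [starlikeDiffExpr, diffExpr, starlikeQuot]
  have hfz := hne z hz hz0
  have hf1 := ((hf z hz).differentiableAt (isOpen_unitDisk.mem_nhds hz)).hasDerivAt
  have hf2 := (((hf.deriv isOpen_unitDisk) z hz).differentiableAt
    (isOpen_unitDisk.mem_nhds hz)).hasDerivAt
  have hq : starlikeQuot f z = z * deriv f z / f z := by simp [starlikeQuot, hz0]
  have hd : HasDerivAt (starlikeQuot f) (((1 * deriv f z + z * deriv (deriv f) z) * f z -
      z * deriv f z * deriv f z) / f z ^ 2) z := by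
    refine (((hasDerivAt_id z).mul hf2).div hf1 hfz).congr_of_eventuallyEq ?_
    filter_upwards [isOpen_ne.mem_nhds hz0] with y hy
    simp only [starlikeQuot, if_neg hy]
    rfl
  rw [starlikeDiffExpr, diffExpr, hd.deriv, hq]
  -- At a zero of `f'` both expressions take the value `1`, because division by zero gives `0`.
  by_cases h : deriv f z = 0
  · simp [h]
  · field_simp
    ring

/-- With `k = f/f'` the expression is `1 + β (k/z - k')`. At a zero `z₀ ≠ 0` of order `m + 1` it
tends to `1 - β/(m + 1)`, since `k(z₀) = 0` and `k'(z₀) = 1/(m + 1)`. There is no pole here: the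
contradiction is with the value at `z₀` itself, which is `1` because division by zero gives `0`, and
with the continuity of `φ_Ne ∘ w`. -/
theorem ne_zero_of_starlikeDiffExpr_subordinate {β : ℝ} (hβ : 0 < β) {f : ℂ → ℂ} (hf : ClassA f)
    (h : Subordinate (starlikeDiffExpr β f) phiNe) : ∀ z ∈ unitDisk, z ≠ 0 → f z ≠ 0 := by
  intro z₀ hz₀ hz₀0 hfz
  obtain ⟨w, hwd, -, -, hw⟩ := h
  have hβ' : (β : ℂ) ≠ 0 := by exact_mod_cast hβ.ne'
  obtain ⟨z₁, hz₁, hfz₁⟩ : ∃ z₁ ∈ unitDisk, f z₁ ≠ 0 := by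
    by_contra! hall
    have : f =ᶠ[𝓝 0] fun _ => 0 := by
      filter_upwards [isOpen_unitDisk.mem_nhds (by simp [unitDisk] : (0 : ℂ) ∈ unitDisk)]
        with z hz using hall z hz
    have h1 := hf.2.2
    rw [this.deriv_eq, deriv_const] at h1
    exact zero_ne_one h1
  obtain ⟨m, g, hg, hg0, hfac⟩ := exists_local_factor hf.1 hz₀ hfz hz₁ hfz₁
  have hm : (m : ℂ) + 1 ≠ 0 := by exact_mod_cast m.succ_ne_zero
  have hwc : ContinuousAt w z₀ := (hwd z₀ hz₀).continuousWithinAt.continuousAt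
    (isOpen_unitDisk.mem_nhds hz₀)
  set K : ℂ → ℂ := fun z => (m + 1) * g z + (z - z₀) * deriv g z with hK
  have hKan : AnalyticAt ℂ K z₀ := by
    have := hg.deriv
    fun_prop
  have hK0 : K z₀ ≠ 0 := by simp [hK, hm, hg0]
  set k : ℂ → ℂ := fun z => (z - z₀) * (g z / K z) with hk
  have hkan : AnalyticAt ℂ k z₀ := (analyticAt_id.sub analyticAt_const).mul (hg.div hKan hK0)
  have hkd : deriv k z₀ = 1 / (m + 1) := by
    have h1 : HasDerivAt k (1 * (g z₀ / K z₀) + (z₀ - z₀) * deriv (fun z => g z / K z) z₀) z₀ :=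
      ((hasDerivAt_id z₀).sub_const z₀).mul
        (hg.div hKan hK0).differentiableAt.hasDerivAt
    rw [h1.deriv]
    simp [hK]
    field_simp
  have hkc := hkan.continuousAt
  have hkc' := hkan.deriv.continuousAt
  have key := tendsto_nhdsNE_eq (z₀ := z₀) (a := fun z => phiNe (w z))
    (b := fun z => 1 + β * (k z / z - deriv k z)) (by unfold phiNe; fun_prop)
    (by fun_prop (disch := assumption)) (by
      have hev : ∀ᶠ z in 𝓝 z₀, z ∈ unitDisk ∧ z ≠ 0 ∧ g z ≠ 0 ∧ K z ≠ 0 ∧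
          f z = (z - z₀) ^ (m + 1) * g z ∧ deriv f z = (z - z₀) ^ m * K z := by
        filter_upwards [isOpen_unitDisk.mem_nhds hz₀, isOpen_ne.mem_nhds hz₀0,
          hg.continuousAt.eventually_ne hg0, hKan.continuousAt.eventually_ne hK0, hfac]
          with z h1 h2 h3 h4 h5 using ⟨h1, h2, h3, h4, h5⟩
      filter_upwards [self_mem_nhdsWithin, hev.eventually_nhds.filter_mono nhdsWithin_le_nhds]
        with z hz hez
      have hz' : z - z₀ ≠ 0 := sub_ne_zero.2 hz
      obtain ⟨hzD, hz0, hgz, hKz, hfz, hfz'⟩ := hez.self_of_nhds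
      have hfz0 : f z ≠ 0 := by rw [hfz]; exact mul_ne_zero (pow_ne_zero _ hz') hgz
      have hfz'0 : deriv f z ≠ 0 := by rw [hfz']; exact mul_ne_zero (pow_ne_zero _ hz') hKz
      have hkf : k =ᶠ[𝓝 z] fun y => f y / deriv f y := by
        filter_upwards [hez, isOpen_ne.mem_nhds (show z ≠ z₀ from hz)] with y hy hyz
        obtain ⟨-, -, hgy, hKy, hfy, hfy'⟩ := hy
        have hy' : y - z₀ ≠ 0 := sub_ne_zero.2 hyz
        rw [hfy, hfy', hk]
        field_simp
        ring
      have hf1 := ((hf.1 z hzD).differentiableAt (isOpen_unitDisk.mem_nhds hzD)).hasDerivAt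
      have hf2 := (((hf.1.deriv isOpen_unitDisk) z hzD).differentiableAt
        (isOpen_unitDisk.mem_nhds hzD)).hasDerivAt
      have hdk : deriv k z = (deriv f z * deriv f z - f z * deriv (deriv f) z) / deriv f z ^ 2 := by
        rw [hkf.deriv_eq]
        exact (hf1.div hf2 hfz'0).deriv
      rw [← hw z hzD, hdk, hkf.self_of_nhds, starlikeDiffExpr, starlikeQuot, if_neg hz0]
      field_simp
      ring)
  rw [← hw z₀ hz₀, hkd] at key
  have hk0 : k z₀ = 0 := by simp [hk]
  rw [hk0, starlikeDiffExpr, starlikeQuot, if_neg hz₀0, hfz] at key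
  simp [hβ'] at key
  exact hm key

theorem differentiableOn_starlikeQuot {f : ℂ → ℂ} (hf : ClassA f)
    (hne : ∀ z ∈ unitDisk, z ≠ 0 → f z ≠ 0) : DifferentiableOn ℂ (starlikeQuot f) unitDisk := by
  obtain ⟨G, hG, hG0, hfG⟩ := hf.exists_eq_mul
  have hGne : ∀ z ∈ unitDisk, G z ≠ 0 := by
    intro z hz h
    rcases eq_or_ne z 0 with rfl | hz0
    · rw [hG0] at h; exact one_ne_zero h
    · exact hne z hz hz0 (by rw [hfG, h, mul_zero])
  refine ((hf.1.deriv isOpen_unitDisk).div hG hGne).congr fun z hz => ?_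
  rcases eq_or_ne z 0 with rfl | hz0
  · simp [starlikeQuot, hG0, hf.2.2]
  · have := hGne z hz
    rw [starlikeQuot, if_neg hz0, hfG z, Pi.div_apply]
    field_simp

/-- The solution of `z f'/f = p` is `f(z) = z exp(∫₀ᶻ (p(t) - 1)/t dt)`; `dslope p 0` is the
integrand. -/
theorem exists_classA_starlikeQuot_eq {p : ℂ → ℂ} (hp : DifferentiableOn ℂ p unitDisk)
    (hp0 : p 0 = 1) (hpne : ∀ z ∈ unitDisk, p z ≠ 0) :
    ∃ f : ℂ → ℂ, ClassA f ∧ (∀ z ∈ unitDisk, z ≠ 0 → f z ≠ 0) ∧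
      (∀ z ∈ unitDisk, deriv f z ≠ 0) ∧ ∀ z ∈ unitDisk, starlikeQuot f z = p z := by
  have h0 : (0 : ℂ) ∈ unitDisk := by simp [unitDisk]
  have hds : DifferentiableOn ℂ (dslope p 0) (ball 0 1) :=
    (Complex.differentiableOn_dslope (isOpen_unitDisk.mem_nhds h0)).2 hp
  obtain ⟨g, hg⟩ := hds.isExactOn_ball
  have hd : ∀ z ∈ unitDisk, HasDerivAt (fun z => z * Complex.exp (g z - g 0))
      (Complex.exp (g z - g 0) * p z) z := by
    intro z hz
    have h1 := (hasDerivAt_id z).mul ((hg z hz).sub_const (g 0)).cexp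
    refine HasDerivAt.congr_deriv (f := fun z => z * Complex.exp (g z - g 0)) h1 ?_
    have h2 := sub_smul_dslope p 0 z
    rw [hp0, sub_zero, smul_eq_mul] at h2
    simp only [id]
    linear_combination Complex.exp (g z - g 0) * h2
  refine ⟨fun z => z * Complex.exp (g z - g 0), ⟨fun z hz =>
    (hd z hz).differentiableAt.differentiableWithinAt, by simp, ?_⟩, fun z _ hz0 =>
    mul_ne_zero hz0 (Complex.exp_ne_zero _), fun z hz => ?_, fun z hz => ?_⟩
  · rw [(hd 0 h0).deriv]; simp [hp0]
  · rw [(hd z hz).deriv]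
    exact mul_ne_zero (Complex.exp_ne_zero _) (hpne z hz)
  · rcases eq_or_ne z 0 with rfl | hz0
    · simp [starlikeQuot, hp0]
    · rw [starlikeQuot, if_neg hz0, (hd z hz).deriv]
      have := Complex.exp_ne_zero (g z - g 0)
      field_simp

theorem Subordinate.congr {f f' g : ℂ → ℂ} (h : Subordinate f g)
    (heq : ∀ z ∈ unitDisk, f' z = f z) : Subordinate f' g := by
  obtain ⟨w, h1, h2, h3, h4⟩ := h
  exact ⟨w, h1, h2, h3, fun z hz => (heq z hz).trans (h4 z hz)⟩

theorem diffExpr_congr (β : ℝ) {p q : ℂ → ℂ} (h : ∀ z ∈ unitDisk, p z = q z) :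
    ∀ z ∈ unitDisk, diffExpr β p z = diffExpr β q z := by
  intro z hz
  have heq : p =ᶠ[𝓝 z] q := by
    filter_upwards [isOpen_unitDisk.mem_nhds hz] with y hy using h y hy
  rw [diffExpr, diffExpr, heq.deriv_eq, h z hz]

/-- A sharp bound for `1 + β z p' / p²` is a sharp bound for the corresponding expression in
`f`, via `p = z f' / f`. -/
theorem SharpSubordinationBound.sharpStarlikeBound {φ : ℂ → ℂ} {b : ℝ} (hb : 0 < b)
    (h : SharpSubordinationBound φ b) : SharpStarlikeBound φ b := by
  refine ⟨fun β hβ f hf hsub => ⟨hf, ?_⟩, fun β hβ hβb => ?_⟩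
  · have hne := ne_zero_of_starlikeDiffExpr_subordinate (hb.trans_le hβ) hf hsub
    exact h.1 β hβ _ (differentiableOn_starlikeQuot hf hne) (by simp [starlikeQuot])
      (hsub.congr fun z hz => (starlikeDiffExpr_eq_diffExpr β hf.1 hne hz).symm)
  · obtain ⟨p, hp, hp0, hpne, hsub, hnot⟩ := h.2 β hβ hβb
    obtain ⟨f, hf, hfne, hfne', hq⟩ := exists_classA_starlikeQuot_eq hp hp0 hpne
    refine ⟨f, hf, hfne, hfne', hsub.congr fun z hz => ?_, fun hst => hnot ?_⟩
    · rw [starlikeDiffExpr_eq_diffExpr β hf.1 hfne hz]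
      exact diffExpr_congr β hq z hz
    · exact hst.2.congr fun z hz => (hq z hz).symm

/-! ### Boundary inequalities: polynomial and rational functions -/

theorem im_sq_eq_of_norm_eq_one {c s : ℝ} (h : ‖(⟨c, s⟩ : ℂ)‖ = 1) : s ^ 2 = 1 - c ^ 2 := by
  have := Complex.sq_norm (⟨c, s⟩ : ℂ)
  rw [h, Complex.normSq_mk] at this
  linarith

theorem re_mul_div (b : ℝ) (W U : ℂ) :
    ((b : ℂ) * (W / U)).re = b * (W.re * U.re + W.im * U.im) / Complex.normSq U := by
  rw [Complex.re_ofReal_mul, Complex.div_re]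
  ring

/-- For `φ(ζ) = U/V` one has `1 - 1/φ(ζ) = W/U` with `W = U - V`; clearing `|U|²` turns each test
into a polynomial inequality in `c = Re ζ`. -/
theorem notMem_region_div_of_re {b : ℝ} {W U : ℂ} (hU : U ≠ 0)
    (h : 8 / 9 * Complex.normSq U ≤ b * (W.re * U.re + W.im * U.im)) :
    (b : ℂ) * (W / U) ∉ nephroidPrimitiveRegion := by
  refine notMem_region_of_le_re ?_
  rwa [re_mul_div, le_div_iff₀ (Complex.normSq_pos.2 hU)]

theorem notMem_region_div_of_re_neg {b : ℝ} {W U : ℂ} (hU : U ≠ 0)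
    (h : b * (W.re * U.re + W.im * U.im) ≤ -(8 / 9) * Complex.normSq U) :
    (b : ℂ) * (W / U) ∉ nephroidPrimitiveRegion := by
  refine notMem_region_of_sq_re ?_
  have : ((b : ℂ) * (W / U)).re ≤ -(8 / 9) := by
    rwa [re_mul_div, div_le_iff₀ (Complex.normSq_pos.2 hU)]
  nlinarith

theorem notMem_region_div_of_normSq {b : ℝ} {W U : ℂ} (hU : U ≠ 0)
    (h : 100 / 81 * Complex.normSq U ≤ b ^ 2 * Complex.normSq W) :
    (b : ℂ) * (W / U) ∉ nephroidPrimitiveRegion := by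
  refine notMem_region_of_normSq ?_
  rw [Complex.normSq_mul, Complex.normSq_ofReal, Complex.normSq_div, mul_div_assoc',
    le_div_iff₀ (Complex.normSq_pos.2 hU), ← pow_two]
  exact h

theorem ofReal_mul_one_sub_inv {b x y : ℝ} (h : b * (1 - x⁻¹) = 8 / 9 * y) :
    (b : ℂ) * (1 - (x : ℂ)⁻¹) = 8 / 9 * (y : ℂ) := by
  have := congrArg Complex.ofReal h
  push_cast at this
  exact this

theorem one_sub_inv_div {U V : ℂ} (hU : U ≠ 0) : 1 - (U / V)⁻¹ = (U - V) / U := by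
  rw [inv_div]; field_simp

theorem re_bounds_of_im_sq_eq {c s : ℝ} (h : s ^ 2 = 1 - c ^ 2) : -1 ≤ c ∧ c ≤ 1 :=
  abs_le.1 (abs_le_one_iff_mul_self_le_one.2 (by nlinarith [sq_nonneg s]))

theorem sharpSubordinationBound_phiCardioid : SharpSubordinationBound phiCardioid (4 / 3) := by
  refine sharpSubordinationBound_of (ε := 1) (by norm_num) (fun z hz => ⟨4 / 3 + 4 / 3 * z, ?_, ?_⟩)
    (by unfold phiCardioid; fun_prop) (fun x y hx hy h => ?_) (by simp [phiCardioid])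
    (fun ζ hζ hne => ?_) (Or.inl rfl) (by norm_num [phiCardioid]) (by norm_num [phiCardioid])
  · have := (((hasDerivAt_id z).const_mul (4 / 3 : ℂ)).const_add 1).add
      ((hasDerivAt_pow 2 z).const_mul (2 / 3 : ℂ))
    refine HasDerivAt.congr_deriv (f := phiCardioid) this ?_
    push_cast; ring
  · intro h
    have : z = -1 := by linear_combination 3 / 4 * h
    rw [this] at hz
    simp at hz
  · by_contra hne
    have h2 : (x - y) * (x + y + 2) = 0 := by
      simp only [phiCardioid] at h
      linear_combination 3 / 2 * h
    rcases mul_eq_zero.1 h2 with h3 | h3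
    · exact hne (sub_eq_zero.1 h3)
    · have h4 : x + y = -2 := by linear_combination h3
      have h5 := norm_add_le x y
      rw [h4, norm_neg, Complex.norm_ofNat] at h5
      linarith
  · obtain ⟨c, s⟩ := ζ
    have hs := im_sq_eq_of_norm_eq_one hζ
    obtain ⟨hc1, hc2⟩ := re_bounds_of_im_sq_eq hs
    have e : phiCardioid ⟨c, s⟩ =
        (⟨3 + 4 * c + 2 * (c ^ 2 - s ^ 2), 4 * s + 4 * c * s⟩ : ℂ) / 3 := by
      apply Complex.ext <;> simp [phiCardioid, pow_two] <;> ring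
    rw [e] at hne ⊢
    have hU := (div_ne_zero_iff.1 hne).1
    rw [one_sub_inv_div hU]
    have hN : Complex.normSq ⟨3 + 4 * c + 2 * (c ^ 2 - s ^ 2), 4 * s + 4 * c * s⟩ =
        17 + 40 * c + 24 * c ^ 2 := by
      rw [Complex.normSq_mk]; grind
    have hW : Complex.normSq (⟨3 + 4 * c + 2 * (c ^ 2 - s ^ 2), 4 * s + 4 * c * s⟩ - 3) =
        20 + 16 * c := by
      rw [Complex.normSq_apply]; simp; grind
    -- The gap in the real-part test is `16/9 (1 - c)(2 + 3c)`; where it is negative the modulus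
    -- test applies.
    rcases le_or_gt (-(2 / 3)) c with h | h
    · have := notMem_region_div_of_re (b := 4 / 3)
        (W := ⟨3 + 4 * c + 2 * (c ^ 2 - s ^ 2), 4 * s + 4 * c * s⟩ - 3) hU (by
          rw [hN]; simp
          have : (4 * c + 2 * (c ^ 2 - s ^ 2)) * (3 + 4 * c + 2 * (c ^ 2 - s ^ 2)) +
            (4 * s + 4 * c * s) * (4 * s + 4 * c * s) = 14 + 28 * c + 12 * c ^ 2 := by grind
          nlinarith [mul_nonneg (by linarith : 0 ≤ c + 2 / 3) (by linarith : 0 ≤ 1 - c)])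
      exact this
    · refine notMem_region_div_of_normSq hU ?_
      rw [hN, hW]
      nlinarith

theorem sqrt_two_bounds : √2 ^ 2 = 2 ∧ 1.41 < √2 ∧ √2 < 1.42 := by
  refine ⟨Real.sq_sqrt zero_le_two, ?_, ?_⟩
  · exact Real.lt_sqrt_of_sq_lt (by norm_num)
  · exact (Real.sqrt_lt' (by norm_num)).2 (by norm_num)

theorem sharpSubordinationBound_phiLimacon :
    SharpSubordinationBound phiLimacon (8 / 63 * (5 + 4 * √2)) := by
  obtain ⟨q, hq⟩ : ∃ q, q = √2 := ⟨_, rfl⟩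
  obtain ⟨hq2, hq3, hq4⟩ := sqrt_two_bounds
  rw [← hq] at hq2 hq3 hq4 ⊢
  have hφ : phiLimacon = fun z => 1 + (q : ℂ) * z + z ^ 2 / 2 := by
    funext z; rw [phiLimacon, hq]
  have hqn : ‖(q : ℂ)‖ = q := by rw [Complex.norm_real, Real.norm_of_nonneg (by linarith)]
  have h1 : 1 + (q : ℂ) * (1 : ℝ) + ((1 : ℝ) : ℂ) ^ 2 / 2 = ((3 / 2 + q : ℝ) : ℂ) := by
    push_cast; ring
  have hpos : (3 / 2 + q : ℝ) ≠ 0 := by linarith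
  rw [hφ]
  refine sharpSubordinationBound_of (ε := 1) (by linarith) (fun z hz => ⟨q + z, ?_, ?_⟩)
    (by fun_prop) (fun x y hx hy h => ?_) (by simp)
    (fun ζ hζ hne => ?_) (Or.inl rfl) (by rw [h1]; exact_mod_cast hpos) ?_
  · have := (((hasDerivAt_id z).const_mul (q : ℂ)).const_add 1).add
      ((hasDerivAt_pow 2 z).div_const (2 : ℂ))
    refine HasDerivAt.congr_deriv (f := fun z : ℂ => 1 + (q : ℂ) * z + z ^ 2 / 2) this ?_
    push_cast; ring
  · intro h
    have : z = -q := by linear_combination h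
    rw [this, norm_neg, hqn] at hz
    linarith
  · by_contra hne
    have h2 : (x - y) * (x + y + 2 * q) = 0 := by
      linear_combination 2 * h
    rcases mul_eq_zero.1 h2 with h3 | h3
    · exact hne (sub_eq_zero.1 h3)
    · have h4 : x + y = -(2 * q) := by linear_combination h3
      have h5 := norm_add_le x y
      rw [h4, norm_neg, norm_mul, hqn, Complex.norm_ofNat] at h5
      linarith
  · obtain ⟨c, s⟩ := ζ
    have hs := im_sq_eq_of_norm_eq_one hζ
    obtain ⟨hc1, hc2⟩ := re_bounds_of_im_sq_eq hs
    have e : (1 + (q : ℂ) * ⟨c, s⟩ + ⟨c, s⟩ ^ 2 / 2 : ℂ) =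
        (⟨2 + 2 * q * c + (c ^ 2 - s ^ 2), 2 * q * s + 2 * c * s⟩ : ℂ) / 2 := by
      apply Complex.ext <;> simp [pow_two] <;> ring
    simp only [e] at hne ⊢
    have hU := (div_ne_zero_iff.1 hne).1
    rw [one_sub_inv_div hU]
    have hN : Complex.normSq ⟨2 + 2 * q * c + (c ^ 2 - s ^ 2), 2 * q * s + 2 * c * s⟩ =
        (3 + 2 * q * c) ^ 2 := by
      rw [Complex.normSq_mk]; grind
    have hW : Complex.normSq (⟨2 + 2 * q * c + (c ^ 2 - s ^ 2), 2 * q * s + 2 * c * s⟩ - 2) =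
        9 + 4 * q * c := by
      rw [Complex.normSq_apply]; simp; grind
    -- This is the cofactor of `1 - c` in the gap of the real-part test, as `e3` shows.
    rcases le_or_gt 0 (3 * q - 2 + (4 - q) * c) with h | h
    · refine notMem_region_div_of_re hU ?_
      rw [hN]; simp
      have e2 : (2 * q * c + (c ^ 2 - s ^ 2)) * (2 + 2 * q * c + (c ^ 2 - s ^ 2)) +
          (2 * q * s + 2 * c * s) * (2 * q * s + 2 * c * s) =
          (3 + 2 * q * c) ^ 2 - 2 * (1 + q * c) ^ 2 := by grind
      have e3 : 8 / 63 * (5 + 4 * q) * ((3 + 2 * q * c) ^ 2 - 2 * (1 + q * c) ^ 2) -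
          8 / 9 * (3 + 2 * q * c) ^ 2 =
          16 / 63 * ((5 + 4 * q) * ((3 - 2 * q) * q)) *
          ((1 - c) * (3 * q - 2 + (4 - q) * c)) := by grind
      have e4 : 0 ≤ (5 + 4 * q) * ((3 - 2 * q) * q) :=
        mul_nonneg (by linarith) (mul_nonneg (by linarith) (by linarith))
      have e5 := mul_nonneg e4 (mul_nonneg (by linarith : 0 ≤ 1 - c) h)
      have e6 : ((2 + 2 * q * c + (c ^ 2 - s ^ 2) - 2) * (2 + 2 * q * c + (c ^ 2 - s ^ 2)) +
          (2 * q * s + 2 * c * s) * (2 * q * s + 2 * c * s)) =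
          (3 + 2 * q * c) ^ 2 - 2 * (1 + q * c) ^ 2 := by rw [← e2]; ring
      rw [e6]
      linarith
    · refine notMem_region_div_of_normSq hU ?_
      rw [hN, hW]
      have h7 : c < -(4 / 5) := by nlinarith
      have h8 : (3 + 2 * q * c) ^ 2 ≤ 1 := by
        rw [sq_le_one_iff_abs_le_one, abs_le]; constructor <;> nlinarith
      have h9 : 3 ≤ 9 + 4 * q * c := by nlinarith
      have h10 : (1 : ℝ) ≤ (8 / 63 * (5 + 4 * q)) ^ 2 := by
        apply one_le_pow₀; linarith
      nlinarith
  · rw [h1]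
    have h2 : 8 / 63 * (5 + 4 * q) * (1 - (3 / 2 + q)⁻¹) = 8 / 9 * 1 := by
      field_simp
      grind
    exact ofReal_mul_one_sub_inv h2

theorem sharpSubordinationBound_phiNe : SharpSubordinationBound phiNe (20 / 9) := by
  refine sharpSubordinationBound_of (ε := 1) (by norm_num) (fun z hz => ⟨1 - z ^ 2, ?_, ?_⟩)
    (by unfold phiNe; fun_prop) (fun x y hx hy h => ?_) (by simp [phiNe])
    (fun ζ hζ hne => ?_) (Or.inl rfl) (by norm_num [phiNe]) (by norm_num [phiNe])
  · have := ((hasDerivAt_id z).const_add 1).sub ((hasDerivAt_pow 3 z).div_const (3 : ℂ))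
    refine HasDerivAt.congr_deriv (f := phiNe) this ?_
    push_cast; ring
  · intro h
    have : z ^ 2 = 1 := by linear_combination -h
    have h2 := congrArg norm this
    rw [norm_pow, norm_one] at h2
    nlinarith [norm_nonneg z]
  · by_contra hne
    have h2 : (x - y) * (x ^ 2 + x * y + y ^ 2 - 3) = 0 := by
      simp only [phiNe] at h
      linear_combination -3 * h
    rcases mul_eq_zero.1 h2 with h3 | h3
    · exact hne (sub_eq_zero.1 h3)
    · have h4 : x ^ 2 + x * y + y ^ 2 = 3 := by linear_combination h3
      have h5 : ‖x ^ 2 + x * y + y ^ 2‖ ≤ ‖x‖ ^ 2 + ‖x‖ * ‖y‖ + ‖y‖ ^ 2 := by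
        refine (norm_add₃_le).trans ?_
        simp [norm_pow]
      rw [h4, Complex.norm_ofNat] at h5
      nlinarith [norm_nonneg x, norm_nonneg y]
  · obtain ⟨c, s⟩ := ζ
    have hs := im_sq_eq_of_norm_eq_one hζ
    obtain ⟨hc1, hc2⟩ := re_bounds_of_im_sq_eq hs
    have e : phiNe ⟨c, s⟩ = (⟨3 + 3 * c - (c ^ 3 - 3 * c * s ^ 2),
        3 * s - (3 * c ^ 2 * s - s ^ 3)⟩ : ℂ) / 3 := by
      have := sub_cube_div_three_eq c s
      rw [phiNe, add_sub_assoc, this]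
      apply Complex.ext <;> simp <;> ring
    have e1 : 3 + 3 * c - (c ^ 3 - 3 * c * s ^ 2) = 3 + 6 * c - 4 * c ^ 3 := by grind
    have e2 : 3 * s - (3 * c ^ 2 * s - s ^ 3) = 4 * s ^ 3 := by grind
    rw [e1, e2] at e
    rw [e] at hne ⊢
    have hU := (div_ne_zero_iff.1 hne).1
    rw [one_sub_inv_div hU]
    have hN : Complex.normSq ⟨3 + 6 * c - 4 * c ^ 3, 4 * s ^ 3⟩ =
        25 + 36 * c - 12 * c ^ 2 - 24 * c ^ 3 := by
      rw [Complex.normSq_mk]; grind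
    have hW : Complex.normSq (⟨3 + 6 * c - 4 * c ^ 3, 4 * s ^ 3⟩ - 3) = 16 - 12 * c ^ 2 := by
      rw [Complex.normSq_apply]; simp; grind
    -- The gap in the real-part test is `8/3 (1 - c)(5 + 8c + 2c²)`.
    rcases le_or_gt 0 (5 + 8 * c + 2 * c ^ 2) with h | h
    · have := notMem_region_div_of_re (b := 20 / 9)
        (W := ⟨3 + 6 * c - 4 * c ^ 3, 4 * s ^ 3⟩ - 3) hU (by
          rw [hN]; simp
          have : (3 + 6 * c - 4 * c ^ 3 - 3) * (3 + 6 * c - 4 * c ^ 3) +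
            4 * s ^ 3 * (4 * s ^ 3) = 25 + 36 * c - 12 * c ^ 2 - 24 * c ^ 3 -
              3 * (3 + 6 * c - 4 * c ^ 3) := by grind
          rw [this]
          nlinarith [mul_nonneg h (by linarith : 0 ≤ 1 - c)])
      exact_mod_cast this
    · have := notMem_region_div_of_normSq (b := 20 / 9)
        (W := ⟨3 + 6 * c - 4 * c ^ 3, 4 * s ^ 3⟩ - 3) hU (by
          rw [hN, hW]
          have h7 : c ≤ -(1 / 2) := by nlinarith
          nlinarith [mul_nonneg (by linarith : 0 ≤ -c) (by nlinarith : 0 ≤ 1 - c ^ 2)])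
      exact_mod_cast this

theorem sharpSubordinationBound_phiZero :
    SharpSubordinationBound phiZero (16 / 9 * (1 + √2)) := by
  obtain ⟨hq2, hq3, hq4⟩ := sqrt_two_bounds
  have hφ : phiZero = fun z => 1 + z / ((1 + √2 : ℝ) : ℂ) *
      ((((1 + √2 : ℝ) : ℂ) + z) / (((1 + √2 : ℝ) : ℂ) - z)) := by
    funext z; rw [phiZero]; push_cast; ring
  rw [hφ]
  have hk : (1 + √2) ^ 2 = 2 * (1 + √2) + 1 := by grind
  have hk1 : 2.4 < 1 + √2 := by linarith
  -- Only `k² = 2k + 1` and `k > 2.4` are used from here on.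
  generalize (1 + √2) = k at hk hk1 ⊢
  have hkc : (k : ℂ) ^ 2 = 2 * k + 1 := by exact_mod_cast congrArg Complex.ofReal hk
  have hk0 : (k : ℂ) ≠ 0 := by
    have : k ≠ 0 := by linarith
    exact_mod_cast this
  have hkn : ‖(k : ℂ)‖ = k := by rw [Complex.norm_real, Real.norm_of_nonneg (by linarith)]
  have hkz : ∀ z : ℂ, ‖z‖ ≤ 1 → (k : ℂ) - z ≠ 0 := by
    intro z hz h
    rw [← sub_eq_zero.1 h, hkn] at hz
    linarith
  have hform : ∀ z : ℂ, ‖z‖ ≤ 1 →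
      1 + z / (k : ℂ) * ((k + z) / (k - z)) = (k ^ 2 + z ^ 2) / (k * (k - z)) := by
    intro z hz
    have := hkz z hz
    field_simp
    ring
  refine sharpSubordinationBound_of (ε := -1) (by linarith)
    (fun z hz => ⟨(k ^ 2 + 2 * k * z - z ^ 2) / (k * (k - z) ^ 2), ?_, ?_⟩)
    ?_ (fun x y hx hy h => ?_) (by simp) (fun ζ hζ hne => ?_) (Or.inr rfl) ?_ ?_
  · have hz' := hkz z hz.le
    have := (((hasDerivAt_id z).div_const (k : ℂ)).mul (((hasDerivAt_id z).const_add (k : ℂ)).div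
      ((hasDerivAt_id z).const_sub (k : ℂ)) hz')).const_add 1
    refine HasDerivAt.congr_deriv
      (f := fun z => 1 + z / (k : ℂ) * ((k + z) / (k - z))) this ?_
    simp
    field_simp
    ring
  · refine div_ne_zero (fun h => ?_) (mul_ne_zero hk0 (pow_ne_zero _ (hkz z hz.le)))
    have h1 : z ^ 2 - 2 * k * z = ((2 * k + 1 : ℝ) : ℂ) := by
      push_cast
      linear_combination -h + hkc
    have h2 := norm_sub_le (z ^ 2) (2 * k * z)
    rw [h1, Complex.norm_real, Real.norm_of_nonneg (by linarith), norm_pow, norm_mul, norm_mul,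
      hkn, Complex.norm_ofNat] at h2
    nlinarith [norm_nonneg z]
  · refine ContinuousOn.add continuousOn_const (ContinuousOn.mul (by fun_prop) ?_)
    exact ContinuousOn.div (by fun_prop) (by fun_prop)
      fun z hz => hkz z (mem_closedBall_zero_iff.1 hz)
  · by_contra hne
    simp only [hform x hx, hform y hy.le] at h
    rw [div_eq_div_iff (mul_ne_zero hk0 (hkz x hx)) (mul_ne_zero hk0 (hkz y hy.le))] at h
    have h2 : (x - y) * (k * (2 * k + 1 + k * (x + y) - x * y)) = 0 := by
      rw [← hkc]
      linear_combination h
    rcases mul_eq_zero.1 h2 with h3 | h3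
    · exact hne (sub_eq_zero.1 h3)
    · have h4 : x * y - k * (x + y) = ((2 * k + 1 : ℝ) : ℂ) := by
        have := (mul_eq_zero.1 h3).resolve_left hk0
        push_cast
        linear_combination -this
      have h5 := norm_sub_le (x * y) (k * (x + y))
      rw [h4, Complex.norm_real, Real.norm_of_nonneg (by linarith), norm_mul, norm_mul, hkn] at h5
      have h6 := norm_add_le x y
      nlinarith [norm_nonneg x, norm_nonneg y]
  · simp only [hform ζ hζ.le] at hne ⊢
    have hU := (div_ne_zero_iff.1 hne).1
    rw [one_sub_inv_div hU]
    obtain ⟨c, s⟩ := ζ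
    have hs := im_sq_eq_of_norm_eq_one hζ
    obtain ⟨hc1, hc2⟩ := re_bounds_of_im_sq_eq hs
    have eU : ((k : ℂ) ^ 2 + ⟨c, s⟩ ^ 2) = ⟨k ^ 2 + (c ^ 2 - s ^ 2), 2 * c * s⟩ := by
      apply Complex.ext <;> simp [pow_two]
      ring
    have eW : ((k : ℂ) ^ 2 + ⟨c, s⟩ ^ 2) - k * (k - ⟨c, s⟩) =
        ⟨(c ^ 2 - s ^ 2) + k * c, 2 * c * s + k * s⟩ := by
      apply Complex.ext <;> simp [pow_two] <;> ring
    rw [eW, eU]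
    rw [eU] at hU
    have hN : Complex.normSq ⟨k ^ 2 + (c ^ 2 - s ^ 2), 2 * c * s⟩ = 4 * k ^ 2 * (1 + c ^ 2) := by
      rw [Complex.normSq_mk]; grind
    have hW : Complex.normSq ⟨(c ^ 2 - s ^ 2) + k * c, 2 * c * s + k * s⟩ =
        1 + k ^ 2 + 2 * k * c := by
      rw [Complex.normSq_mk]; grind
    -- The extremal point is `-1`, so the half-plane is `Re v ≤ -8/9`; the gap there is a positive
    -- multiple of `-c (c + 1)`.
    rcases le_or_gt c 0 with h | h
    · refine notMem_region_div_of_re_neg hU ?_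
      rw [hN]
      have e : ((c ^ 2 - s ^ 2) + k * c) * (k ^ 2 + (c ^ 2 - s ^ 2)) +
          (2 * c * s + k * s) * (2 * c * s) =
          2 * k * (k + 1) * (c * (c + 1)) - 2 * k * (1 + c ^ 2) := by grind
      simp only [e]
      have h1 : k ^ 2 * (k + 1) * (c * (c + 1)) ≤ 0 :=
        mul_nonpos_of_nonneg_of_nonpos (by positivity)
          (mul_nonpos_of_nonpos_of_nonneg h (by linarith))
      linarith
    · refine notMem_region_div_of_normSq hU ?_
      rw [hN, hW]
      have h1 : 400 * (1 + c ^ 2) ≤ 256 * (1 + k ^ 2 + 2 * k * c) := by nlinarith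
      have h2 := mul_le_mul_of_nonneg_left h1 (sq_nonneg k)
      linarith
  · have := hform ((-1 : ℝ) : ℂ) (by simp)
    rw [this]
    refine div_ne_zero ?_ (mul_ne_zero hk0 (hkz _ (by simp)))
    have : k ^ 2 + (-1) ^ 2 ≠ 0 := by positivity
    exact_mod_cast this
  · have e : 1 + ((-1 : ℝ) : ℂ) / (k : ℂ) * ((k + (-1 : ℝ)) / (k - (-1 : ℝ))) = 2 / k := by
      rw [hform ((-1 : ℝ) : ℂ) (by simp), div_eq_div_iff (mul_ne_zero hk0 (hkz _ (by simp))) hk0]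
      push_cast
      rw [hkc]; ring
    rw [e, inv_div]
    push_cast
    linear_combination (-8 / 9) * hkc

/-! ### The crescent function -/

theorem sq_sqrt_complex (a : ℂ) : Complex.sqrt a ^ 2 = a := by
  rw [Complex.sqrt]
  exact Complex.cpow_nat_inv_pow a two_ne_zero

theorem phiCrescent_mul (z : ℂ) : phiCrescent z * (Complex.sqrt (1 + z ^ 2) - z) = 1 := by
  rw [phiCrescent]
  linear_combination sq_sqrt_complex (1 + z ^ 2)

theorem phiCrescent_ne_zero (z : ℂ) : phiCrescent z ≠ 0 :=
  left_ne_zero_of_mul (by rw [phiCrescent_mul]; exact one_ne_zero)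

theorem inv_phiCrescent (z : ℂ) : (phiCrescent z)⁻¹ = Complex.sqrt (1 + z ^ 2) - z :=
  inv_eq_of_mul_eq_one_right (phiCrescent_mul z)

/-- This recovers `z` from the value, which gives injectivity, and on `|z| = 1` yields the equation
of the boundary arcs. -/
theorem two_mul_eq_phiCrescent_sub_inv (z : ℂ) : phiCrescent z - (phiCrescent z)⁻¹ = 2 * z := by
  rw [inv_phiCrescent, phiCrescent]; ring

theorem re_one_add_sq_nonneg {z : ℂ} (hz : ‖z‖ ≤ 1) :
    0 ≤ (1 + z ^ 2).re ∧ (‖z‖ < 1 → 0 < (1 + z ^ 2).re) := by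
  have h1 : ‖z ^ 2‖ = ‖z‖ ^ 2 := norm_pow z 2
  have h2 := (abs_le.1 (Complex.abs_re_le_norm (z ^ 2))).1
  rw [Complex.add_re, Complex.one_re]
  constructor
  · nlinarith [norm_nonneg z]
  · intro h; nlinarith [norm_nonneg z]

theorem sharpSubordinationBound_phiCrescent :
    SharpSubordinationBound phiCrescent (4 / 9 * (2 + √2)) := by
  obtain ⟨hq2, hq3, hq4⟩ := sqrt_two_bounds
  have h1 : phiCrescent (1 : ℝ) = ((1 + √2 : ℝ) : ℂ) := by
    have : Complex.sqrt (1 + ((1 : ℝ) : ℂ) ^ 2) = (√2 : ℝ) := by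
      have : (1 + ((1 : ℝ) : ℂ) ^ 2) = ((2 : ℝ) : ℂ) := by norm_num
      rw [this, Complex.sqrt_of_nonneg (Complex.zero_le_real.2 zero_le_two)]
      simp
    rw [phiCrescent, this]; push_cast; ring
  refine sharpSubordinationBound_of (ε := 1) (by linarith)
    (fun z hz => ⟨1 + (1 + z ^ 2) ^ (-1 / 2 : ℂ) / 2 * (2 * z), ?_, ?_⟩)
    (fun z hz => ?_) (fun x y hx hy h => ?_) (by simp [phiCrescent])
    (fun ζ hζ hne => ?_) (Or.inl rfl) (phiCrescent_ne_zero _) ?_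
  · have hs : 1 + z ^ 2 ∈ Complex.slitPlane := Or.inl ((re_one_add_sq_nonneg hz.le).2 hz)
    have h2 : HasDerivAt (fun z : ℂ => 1 + z ^ 2) (2 * z) z := by
      simpa using (hasDerivAt_pow 2 z).const_add 1
    exact (hasDerivAt_id z).add (HasDerivAt.comp (h₂ := Complex.sqrt) z
      (Complex.hasDerivAt_sqrt hs) h2)
  · have h0 : 1 + z ^ 2 ≠ 0 := fun h => by
      have := (re_one_add_sq_nonneg hz.le).2 hz
      rw [h] at this
      simp at this
    have h2 : Complex.sqrt (1 + z ^ 2) ≠ 0 := fun h =>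
      h0 (by rw [← sq_sqrt_complex (1 + z ^ 2), h]; simp)
    have h3 : (1 + z ^ 2) ^ (-1 / 2 : ℂ) = (Complex.sqrt (1 + z ^ 2))⁻¹ := by
      rw [Complex.sqrt, ← Complex.cpow_neg]; norm_num
    rw [h3]
    have h4 : 1 + (Complex.sqrt (1 + z ^ 2))⁻¹ / 2 * (2 * z) =
        phiCrescent z / Complex.sqrt (1 + z ^ 2) := by
      rw [phiCrescent]; field_simp; ring
    rw [h4]
    exact div_ne_zero (phiCrescent_ne_zero z) h2
  · have h2 : ContinuousAt Complex.sqrt (1 + z ^ 2) := Complex.continuousAt_sqrt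
      (Or.inl (re_one_add_sq_nonneg (mem_closedBall_zero_iff.1 hz)).1)
    have h3 : ContinuousAt (fun z : ℂ => 1 + z ^ 2) z := by fun_prop
    exact (continuousAt_id.add (h2.comp (f := fun z : ℂ => 1 + z ^ 2) h3)).continuousWithinAt
  · have hx' := two_mul_eq_phiCrescent_sub_inv x
    rw [h, two_mul_eq_phiCrescent_sub_inv y] at hx'
    linear_combination (-1 / 2) * hx'
  · have h2 := two_mul_eq_phiCrescent_sub_inv ζ
    set P := (phiCrescent ζ)⁻¹ with hP
    have hP0 : P ≠ 0 := inv_ne_zero hne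
    have hφP : phiCrescent ζ = P⁻¹ := by rw [hP, inv_inv]
    rw [hφP] at h2
    have h3 : 1 - P ^ 2 = 2 * ζ * P := by
      rw [← h2]; field_simp
    have h4 := congrArg Complex.normSq h3
    have hζ2 : Complex.normSq ζ = 1 := by rw [Complex.normSq_eq_norm_sq, hζ, one_pow]
    rw [Complex.normSq_mul, Complex.normSq_mul, hζ2] at h4
    obtain ⟨x, y⟩ := P
    have e : (1 - (⟨x, y⟩ : ℂ) ^ 2) = ⟨1 - (x ^ 2 - y ^ 2), -(2 * x * y)⟩ := by
      apply Complex.ext <;> simp [pow_two]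
      ring
    rw [e, Complex.normSq_mk, Complex.normSq_ofNat, Complex.normSq_mk] at h4
    -- The reciprocal `P` lies on one of the circles `|P + 1| = √2` and `|P - 1| = √2`. On the first
    -- `Re P ≤ √2 - 1`, on the second `|1 - P| = √2`.
    have h5 : (x ^ 2 + y ^ 2 + 2 * x - 1) * (x ^ 2 + y ^ 2 - 2 * x - 1) = 0 := by
      linear_combination h4
    rcases mul_eq_zero.1 h5 with h6 | h6
    · apply notMem_region_of_le_re
      rw [Complex.re_ofReal_mul]
      simp only [Complex.sub_re, Complex.one_re]
      have hx : x ≤ √2 - 1 := by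
        by_contra hlt
        nlinarith [sq_nonneg y]
      nlinarith
    · apply notMem_region_of_normSq
      rw [Complex.normSq_mul, Complex.normSq_ofReal, Complex.normSq_apply]
      simp
      have : (1 - x) * (1 - x) + y * y = 2 := by linear_combination h6
      rw [this]
      nlinarith
  · rw [h1]
    have : (1 + √2) ≠ 0 := by positivity
    have h2 : 4 / 9 * (2 + √2) * (1 - (1 + √2)⁻¹) = 8 / 9 * 1 := by
      field_simp
      grind
    exact ofReal_mul_one_sub_inv h2

/-! ### The sine function -/

theorem sin_eq_sin_of_norm_lt {x y : ℂ} (hx : ‖x‖ ≤ 1) (hy : ‖y‖ < 1)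
    (h : Complex.sin x = Complex.sin y) : x = y := by
  have hxr := abs_le.1 ((Complex.abs_re_le_norm x).trans hx)
  have hyr := abs_le.1 ((Complex.abs_re_le_norm y).trans hy.le)
  have hpi := Real.pi_gt_three
  obtain ⟨k, hk | hk⟩ := Complex.sin_eq_sin_iff.1 h
  · have hre : y.re = 2 * k * Real.pi + x.re := by
      have := congrArg Complex.re hk
      simpa using this
    have hk0 : k = 0 := by
      by_contra hne
      rcases lt_or_gt_of_ne hne with h1 | h1
      · have : (k : ℝ) ≤ -1 := by exact_mod_cast Int.le_sub_one_of_lt h1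
        nlinarith
      · have : (1 : ℝ) ≤ k := by exact_mod_cast h1
        nlinarith
    rw [hk, hk0]; simp
  · exfalso
    have hre : y.re = (2 * k + 1) * Real.pi - x.re := by
      have := congrArg Complex.re hk
      simpa using this
    rcases lt_or_ge k 0 with h1 | h1
    · have : (k : ℝ) ≤ -1 := by exact_mod_cast Int.le_sub_one_of_lt h1
      nlinarith
    · have : (0 : ℝ) ≤ k := by exact_mod_cast h1
      nlinarith

theorem mul_sin_one_le_sin {c : ℝ} (h0 : 0 ≤ c) (h1 : c ≤ 1) : c * Real.sin 1 ≤ Real.sin c := by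
  have hpi := Real.pi_gt_three
  have := strictConcaveOn_sin_Icc.concaveOn.2 (x := 0) (y := 1) ⟨le_rfl, by linarith⟩
    ⟨zero_le_one, by linarith⟩ (sub_nonneg.2 h1) h0 (by ring)
  simpa using this

theorem sq_le_sinh_sq (s : ℝ) : s ^ 2 ≤ Real.sinh s ^ 2 := by
  rcases le_total 0 s with h | h
  · exact pow_le_pow_left₀ h (Real.self_le_sinh_iff.2 h) 2
  · have := pow_le_pow_left₀ (neg_nonneg.2 h) (Real.self_le_sinh_iff.2 (neg_nonneg.2 h)) 2
    rwa [Real.sinh_neg, neg_sq, neg_sq] at this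

theorem sharpSubordinationBound_phiSin :
    SharpSubordinationBound phiSin (8 * (1 + Real.sin 1) / (9 * Real.sin 1)) := by
  have hS1 : 5 / 6 < Real.sin 1 := by
    have := Real.sin_gt_sub_cube one_pos
    norm_num at this ⊢; linarith
  have hS2 : Real.sin 1 ≤ 1 := Real.sin_le_one 1
  obtain ⟨S, hS⟩ : ∃ S, S = Real.sin 1 := ⟨_, rfl⟩
  rw [← hS] at hS1 hS2 ⊢
  have hS0 : 0 < S := by linarith
  have h1 : phiSin (1 : ℝ) = ((1 + S : ℝ) : ℂ) := by rw [phiSin, hS]; push_cast; rfl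
  obtain ⟨b, hb⟩ : ∃ b, b = 8 * (1 + S) / (9 * S) := ⟨_, rfl⟩
  have hbS : b * S = 8 / 9 * (1 + S) := by rw [hb]; field_simp
  have hb1 : 16 / 9 ≤ b := by rw [hb, le_div_iff₀ (by positivity)]; linarith
  rw [← hb]
  refine sharpSubordinationBound_of (ε := 1) (by linarith) (fun z hz => ⟨Complex.cos z, ?_, ?_⟩)
    (by unfold phiSin; fun_prop) (fun x y hx hy h => ?_) (by simp [phiSin])
    (fun ζ hζ hne => ?_) (Or.inl rfl) (by rw [h1]; exact_mod_cast (by linarith : (1 + S) ≠ 0)) ?_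
  · exact (Complex.hasDerivAt_sin z).const_add 1
  · intro h
    obtain ⟨k, hk⟩ := Complex.cos_eq_zero_iff.1 h
    have hre : z.re = (2 * k + 1) * Real.pi / 2 := by
      rw [hk]
      have : ((2 * k + 1) * Real.pi / 2 : ℂ) = (((2 * k + 1) * Real.pi / 2 : ℝ) : ℂ) := by
        push_cast; rfl
      rw [this, Complex.ofReal_re]
    have hzr := abs_le.1 ((Complex.abs_re_le_norm z).trans hz.le)
    have hpi := Real.pi_gt_three
    rcases lt_or_ge k 0 with h1 | h1
    · have : (k : ℝ) ≤ -1 := by exact_mod_cast Int.le_sub_one_of_lt h1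
      nlinarith
    · have : (0 : ℝ) ≤ k := by exact_mod_cast h1
      nlinarith
  · exact sin_eq_sin_of_norm_lt hx hy (add_left_cancel h)
  · have e0 : 1 - (phiSin ζ)⁻¹ = (phiSin ζ - 1) / phiSin ζ := by field_simp
    rw [e0]
    obtain ⟨c, s⟩ := ζ
    have hs := im_sq_eq_of_norm_eq_one hζ
    obtain ⟨hc1, hc2⟩ := re_bounds_of_im_sq_eq hs
    have hsin := Complex.sin_eq ⟨c, s⟩
    obtain ⟨X, hX⟩ : ∃ X, X = Real.sin c * Real.cosh s := ⟨_, rfl⟩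
    obtain ⟨Y, hY⟩ : ∃ Y, Y = Real.cos c * Real.sinh s := ⟨_, rfl⟩
    have e : phiSin ⟨c, s⟩ = ⟨1 + X, Y⟩ := by
      rw [phiSin, hsin, hX, hY]
      apply Complex.ext <;> simp [← Complex.ofReal_sin, ← Complex.ofReal_cos,
        ← Complex.ofReal_sinh, ← Complex.ofReal_cosh]
    have e1 : phiSin ⟨c, s⟩ - 1 = ⟨X, Y⟩ := by
      rw [e]; apply Complex.ext <;> simp
    rw [e1, e]
    rw [e] at hne
    have hM : X * X + Y * Y = Real.sin c ^ 2 + Real.sinh s ^ 2 := by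
      have h2 := Real.cosh_sq s
      have h3 := Real.sin_sq_add_cos_sq c
      rw [hX, hY]; grind
    have hM2 : Real.sin c ^ 2 + (1 - c ^ 2) ≤ X * X + Y * Y := by
      rw [hM, ← hs]; linarith [sq_le_sinh_sq s]
    rcases le_or_gt 0 c with h | h
    · refine notMem_region_div_of_re hne ?_
      rw [Complex.normSq_mk]
      have h2 := mul_sin_one_le_sin h hc2
      rw [← hS] at h2
      have hcS : 0 ≤ c * S := by positivity
      have h3 : Real.sin c ≤ X := by
        rw [hX]; exact le_mul_of_one_le_right (hcS.trans h2) (Real.one_le_cosh s)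
      have h4 : (c * S) ^ 2 ≤ Real.sin c ^ 2 := pow_le_pow_left₀ hcS h2 2
      have h5 : 0 ≤ (1 - S) * ((1 - c) * (1 + (1 + S) * c)) := by
        have : 0 ≤ 1 - S := by linarith
        have : 0 ≤ 1 - c := by linarith
        positivity
      have h6 : (1 - S) * (c * S) ≤ (1 - S) * X :=
        mul_le_mul_of_nonneg_left (h2.trans h3) (by linarith)
      -- Up to the factor `8/9`, this is `S` times the gap in the real-part test. Inserting `X ≥ cS`
      -- and `X² + Y² ≥ c²S² + 1 - c²` leaves the product in `h5`.
      have h7 : 0 ≤ X * X + Y * Y + (1 - S) * X - S := by nlinarith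
      have h8 : S * (8 / 9 * ((1 + X) * (1 + X) + Y * Y)) ≤
          S * (b * (X * (1 + X) + Y * Y)) := by
        have : S * (b * (X * (1 + X) + Y * Y)) = 8 / 9 * (1 + S) * (X * (1 + X) + Y * Y) := by
          rw [← hbS]; ring
        rw [this]; nlinarith
      exact le_of_mul_le_mul_left h8 hS0
    · refine notMem_region_div_of_normSq hne ?_
      rw [Complex.normSq_mk, Complex.normSq_mk]
      have h2 := mul_sin_one_le_sin (c := -c) (by linarith) (by linarith)
      rw [← hS, Real.sin_neg] at h2
      have hcS : 0 ≤ -c * S := mul_nonneg (by linarith) hS0.le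
      have h4 : (-c * S) ^ 2 ≤ (-Real.sin c) ^ 2 := pow_le_pow_left₀ hcS h2 2
      have hX0 : X ≤ 0 := by
        rw [hX]
        exact mul_nonpos_of_nonpos_of_nonneg (by linarith) (Real.cosh_pos s).le
      have hSS : S ^ 2 ≤ 1 := pow_le_one₀ hS0.le hS2
      have h5 : S ^ 2 ≤ X * X + Y * Y := by
        have : 0 ≤ (1 - S ^ 2) * (1 - c ^ 2) :=
          mul_nonneg (by linarith) (by rw [← hs]; positivity)
        nlinarith
      have h6 : 2 / 3 ≤ X * X + Y * Y := by nlinarith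
      have h7 : 256 / 81 ≤ b ^ 2 := by nlinarith
      nlinarith
  · rw [h1]
    have h2 : b * (1 - (1 + S)⁻¹) = 8 / 9 * 1 := by
      have : 1 + S ≠ 0 := by linarith
      field_simp
      linarith
    exact ofReal_mul_one_sub_inv h2

/-! ### The exponential function -/

theorem cos_le_quartic {x : ℝ} (hx : 0 ≤ x) : Real.cos x ≤ 1 - x ^ 2 / 2 + x ^ 4 / 24 := by
  have hd : ∀ y : ℝ, HasDerivAt (fun y => 1 - y ^ 2 / 2 + y ^ 4 / 24 - Real.cos y)
      (-y + y ^ 3 / 6 + Real.sin y) y := by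
    intro y
    have := ((((hasDerivAt_pow 2 y).div_const 2).const_sub 1).add
      ((hasDerivAt_pow 4 y).div_const 24)).sub (Real.hasDerivAt_cos y)
    refine HasDerivAt.congr_deriv
      (f := fun y => 1 - y ^ 2 / 2 + y ^ 4 / 24 - Real.cos y) this ?_
    push_cast; ring
  have hmono : MonotoneOn (fun y => 1 - y ^ 2 / 2 + y ^ 4 / 24 - Real.cos y) (Set.Ici 0) := by
    refine monotoneOn_of_deriv_nonneg (convex_Ici 0)
      (fun y _ => (hd y).continuousAt.continuousWithinAt)
      (fun y _ => (hd y).differentiableAt.differentiableWithinAt) fun y hy => ?_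
    rw [interior_Ici] at hy
    rw [(hd y).deriv]
    have := Real.sin_gt_sub_cube hy
    linarith
  have := hmono (Set.mem_Ici.2 le_rfl) (Set.mem_Ici.2 hx) hx
  norm_num at this
  linarith

theorem sub_le_sin_sq {s : ℝ} (hs : s ^ 2 ≤ 1) : s ^ 2 - s ^ 4 / 3 ≤ Real.sin s ^ 2 := by
  wlog h : 0 ≤ s generalizing s
  · have := this (s := -s) (by rwa [neg_sq]) (by linarith)
    rw [Real.sin_neg, neg_sq, neg_sq, Even.neg_pow (by decide)] at this
    exact this
  rcases h.eq_or_lt with rfl | h0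
  · simp
  have h1 := (Real.sin_gt_sub_cube h0).le
  have h2 : 0 ≤ s - s ^ 3 / 6 := by nlinarith [pow_pos h0 3]
  have h3 := pow_le_pow_left₀ h2 h1 2
  nlinarith [sq_nonneg (s ^ 3)]

theorem cos_le_quartic' (s : ℝ) : Real.cos s ≤ 1 - s ^ 2 / 2 + s ^ 4 / 24 := by
  rcases le_total 0 s with h | h
  · exact cos_le_quartic h
  · have := cos_le_quartic (neg_nonneg.2 h)
    rwa [Real.cos_neg, neg_sq, Even.neg_pow (by decide)] at this

/-- Here `t = 1 - Re ζ`. The expansion at `t = 0` is `1 + t²/6 + ⋯`; the larger coefficient `7/20`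
absorbs the remainder up to `t = 3/5`. -/
theorem exp_mul_cos_le {t s : ℝ} (h0 : 0 ≤ t) (h1 : t ≤ 3 / 5) (hs : s ^ 2 = 2 * t - t ^ 2) :
    Real.exp t * Real.cos s ≤ 1 + 7 / 20 * t ^ 2 := by
  have hexp : Real.exp t ≤ 1 + t + t ^ 2 / 2 + t ^ 3 / 5 := by
    have := Real.exp_bound' h0 (by linarith) (n := 4) (by norm_num)
    simp [Finset.sum_range_succ, Nat.factorial] at this
    nlinarith [pow_nonneg h0 3]
  have hcos : Real.cos s ≤ 1 - t + 2 / 3 * t ^ 2 - 7 / 50 * t ^ 3 := by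
    have h4 : s ^ 4 = (2 * t - t ^ 2) ^ 2 := by rw [← hs]; ring
    have := cos_le_quartic' s
    rw [h4, hs] at this
    nlinarith [pow_nonneg h0 3]
  have hpos : 0 ≤ 1 - t + 2 / 3 * t ^ 2 - 7 / 50 * t ^ 3 := by nlinarith [pow_nonneg h0 3]
  calc Real.exp t * Real.cos s
      ≤ Real.exp t * (1 - t + 2 / 3 * t ^ 2 - 7 / 50 * t ^ 3) :=
        mul_le_mul_of_nonneg_left hcos (Real.exp_pos t).le
    _ ≤ (1 + t + t ^ 2 / 2 + t ^ 3 / 5) * (1 - t + 2 / 3 * t ^ 2 - 7 / 50 * t ^ 3) :=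
        mul_le_mul_of_nonneg_right hexp hpos
    _ ≤ 1 + 7 / 20 * t ^ 2 := by
        have h3 : t ^ 3 ≤ 27 / 125 := by
          calc t ^ 3 ≤ (3 / 5) ^ 3 := pow_le_pow_left₀ h0 h1 3
            _ = _ := by norm_num
        have h5 : 0 ≤ t ^ 2 * (7 / 20 - 1 / 6 - 17 / 75 * t + 1 / 150 * t ^ 2 - 19 / 300 * t ^ 3
            + 7 / 250 * t ^ 4) :=
          mul_nonneg (sq_nonneg t) (by nlinarith [sq_nonneg t, sq_nonneg (t ^ 2)])
        nlinarith

theorem two_mul_le_exp_mul_sin_sq {t s : ℝ} (h0 : 0 ≤ t) (h1 : t ≤ 3 / 5)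
    (hs : s ^ 2 = 2 * t - t ^ 2) : 2 * t ≤ (Real.exp t * Real.sin s) ^ 2 := by
  have hsin := sub_le_sin_sq (s := s) (by rw [hs]; nlinarith [sq_nonneg (1 - t)])
  have h4 : s ^ 4 = (2 * t - t ^ 2) ^ 2 := by rw [← hs]; ring
  rw [h4, hs] at hsin
  have hexp : 1 + 2 * t ≤ Real.exp t ^ 2 := by
    rw [← Real.exp_nat_mul]
    have := Real.add_one_le_exp (((2 : ℕ) : ℝ) * t)
    push_cast at this ⊢
    linarith
  rw [mul_pow]
  calc 2 * t ≤ (1 + 2 * t) * (2 * t - t ^ 2 - (2 * t - t ^ 2) ^ 2 / 3) := by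
        have : 0 ≤ t ^ 2 * (5 - 10 * t + 7 * t ^ 2 - 2 * t ^ 3) :=
          mul_nonneg (sq_nonneg t) (by nlinarith [sq_nonneg (t - 3 / 5), sq_nonneg t])
        nlinarith
    _ ≤ (1 + 2 * t) * Real.sin s ^ 2 := mul_le_mul_of_nonneg_left hsin (by linarith)
    _ ≤ _ := mul_le_mul_of_nonneg_right hexp (sq_nonneg _)

theorem le_normSq_one_sub_exp_neg {c s : ℝ} (hs : s ^ 2 = 1 - c ^ 2) (hc : c ≤ 2 / 5) :
    5 / 8 ≤ (1 - Real.exp (-c) * Real.cos s) ^ 2 + (Real.exp (-c) * Real.sin s) ^ 2 := by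
  have hsc := Real.sin_sq_add_cos_sq s
  -- In this form the terms can be bounded separately: both contribute for `c ≤ 0`, and `sin² s`
  -- alone suffices for `0 ≤ c ≤ 2/5`.
  have e : (1 - Real.exp (-c) * Real.cos s) ^ 2 + (Real.exp (-c) * Real.sin s) ^ 2 =
      (Real.exp (-c) - Real.cos s) ^ 2 + Real.sin s ^ 2 := by
    linear_combination (Real.exp (-c) ^ 2 - 1) * hsc
  rw [e]
  have hs1 : s ^ 2 ≤ 1 := by nlinarith [sq_nonneg c]
  have h4 : s ^ 4 = (s ^ 2) ^ 2 := by ring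
  rcases le_total c 0 with h | h
  · have h1 := Real.add_one_le_exp (-c)
    have h2 := Real.cos_le_one s
    have h3 : (-c) ^ 2 ≤ (Real.exp (-c) - Real.cos s) ^ 2 :=
      pow_le_pow_left₀ (by linarith) (by linarith) 2
    have h5 := sub_le_sin_sq hs1
    nlinarith [sq_nonneg s]
  · have h1 := cos_le_quartic' s
    have h2 : 0 ≤ Real.cos s := by
      have := Real.one_sub_sq_div_two_le_cos (x := s)
      linarith
    have h3 : 21 / 25 ≤ s ^ 2 := by rw [hs]; nlinarith
    have h5 : Real.cos s ≤ 0.61 := by rw [h4] at h1; nlinarith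
    nlinarith [sq_nonneg (Real.exp (-c) - Real.cos s)]

/-- Let `Q = X² + Y² - 1`. Since `Y² = Q + (1 - X²)` and the square is at least `1 + 64/27 Q`, it
suffices that `1 - X² ≤ 64/27 Q²`. The left side is at most of order `t²`, and `Q` grows at least
linearly in `t`. -/
theorem le_mul_sq_of_near_right_endpoint {μ t X Y : ℝ} (hμ : 0.5819 < μ) (h0 : 0 ≤ t) (h1 : t ≤ 3 / 5)
    (hX : 1 - X ≤ 7 / 20 * μ * t ^ 2) (hY : 2 * μ ^ 2 * t ≤ Y ^ 2) :
    0 ≤ X ^ 2 + Y ^ 2 - 1 ∧ Y ^ 2 ≤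
      (X ^ 2 + Y ^ 2 - 1) * (1 + 3 / 2 * (64 / 81 * (X ^ 2 + Y ^ 2 - 1))) ^ 2 := by
  have hδ : 1 - X ^ 2 ≤ 7 / 10 * μ * t ^ 2 := by linarith [sq_nonneg (1 - X)]
  obtain ⟨Q, hQ⟩ : ∃ Q, Q = X ^ 2 + Y ^ 2 - 1 := ⟨_, rfl⟩
  rw [← hQ]
  have hμ0 : 0 < μ := by linarith
  have hμt : 0 ≤ μ * t := mul_nonneg hμ0.le h0
  have hQ1 : 0.74 * (μ * t) ≤ Q := by
    have h5 : μ * t * 0.74 ≤ μ * t * (2 * μ - 7 / 10 * t) :=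
      mul_le_mul_of_nonneg_left (by linarith) hμt
    linarith
  have hQ0 : 0 ≤ Q := le_trans (by positivity) hQ1
  have hQ2 : 1 - X ^ 2 ≤ 64 / 27 * Q ^ 2 := by
    have h6 := pow_le_pow_left₀ (by positivity) hQ1 2
    have h8 : 7 / 10 * (μ * t ^ 2) ≤ 64 / 27 * 0.74 ^ 2 * μ * (μ * t ^ 2) :=
      mul_le_mul_of_nonneg_right (by norm_num; linarith) (by positivity)
    calc 1 - X ^ 2 ≤ 7 / 10 * (μ * t ^ 2) := by linarith
      _ ≤ 64 / 27 * 0.74 ^ 2 * μ * (μ * t ^ 2) := h8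
      _ = 64 / 27 * (0.74 * (μ * t)) ^ 2 := by ring
      _ ≤ _ := by linarith
  refine ⟨hQ0, ?_⟩
  calc Y ^ 2 ≤ Q * (1 + 64 / 27 * Q) := by linarith
    _ ≤ Q * (1 + 3 / 2 * (64 / 81 * Q)) ^ 2 :=
      mul_le_mul_of_nonneg_left (by linarith [sq_nonneg Q]) hQ0

/-- Near `ζ = 1` the real part of `b (1 - e^{-ζ})` drops below `8/9` to second order in `t = 1 - Re
ζ`, so the half-plane test fails and the curve is compared with the region's own equation. For `Re ζ
≤ 2/5` the modulus test is enough. -/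
theorem sharpSubordinationBound_exp :
    SharpSubordinationBound Complex.exp (8 * Real.exp 1 / (9 * (Real.exp 1 - 1))) := by
  have he1 := Real.exp_one_gt_d9
  have he2 := Real.exp_one_lt_d9
  obtain ⟨e, he⟩ : ∃ e, e = Real.exp 1 := ⟨_, rfl⟩
  rw [← he] at he1 he2 ⊢
  have hepos : 0 < e := by linarith
  have hem1 : 0 < e - 1 := by linarith
  obtain ⟨μ, hμ⟩ : ∃ μ, μ = 1 / (e - 1) := ⟨_, rfl⟩
  have hμe : μ * (e - 1) = 1 := by rw [hμ]; field_simp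
  have hμ1 : 0.5819 < μ := by rw [hμ, lt_div_iff₀ hem1]; linarith
  have hμ2 : μ < 0.59 := by rw [hμ, div_lt_iff₀ hem1]; linarith
  have hb : 8 * e / (9 * (e - 1)) = 8 / 9 * (μ * e) := by rw [hμ]; field_simp
  rw [hb]
  have h1 : Complex.exp (1 : ℝ) = (e : ℂ) := by rw [he]; push_cast; rfl
  refine sharpSubordinationBound_of (ε := 1) (by linarith)
    (fun z hz => ⟨Complex.exp z, Complex.hasDerivAt_exp z, Complex.exp_ne_zero z⟩)
    (by fun_prop) (fun x y hx hy h => ?_) Complex.exp_zero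
    (fun ζ hζ hne => ?_) (Or.inl rfl) (Complex.exp_ne_zero _) ?_
  · have hxr := abs_le.1 ((Complex.abs_im_le_norm x).trans hx)
    have hyr := abs_le.1 ((Complex.abs_im_le_norm y).trans hy.le)
    have hpi := Real.pi_gt_three
    exact Complex.exp_inj_of_neg_pi_lt_of_le_pi (by linarith) (by linarith) (by linarith)
      (by linarith) h
  · rw [← Complex.exp_neg]
    obtain ⟨c, s⟩ := ζ
    have hs := im_sq_eq_of_norm_eq_one hζ
    obtain ⟨hc1, hc2⟩ := re_bounds_of_im_sq_eq hs
    obtain ⟨v, hv⟩ : ∃ v : ℂ, v = ((8 / 9 * (μ * e) : ℝ) : ℂ) * (1 - Complex.exp (-⟨c, s⟩)) :=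
      ⟨_, rfl⟩
    rw [← hv]
    have hre : v.re = 8 / 9 * (μ * e * (1 - Real.exp (-c) * Real.cos s)) := by
      rw [hv, Complex.re_ofReal_mul, Complex.sub_re, Complex.exp_re]
      simp; ring
    have him : v.im = 8 / 9 * (μ * e * (Real.exp (-c) * Real.sin s)) := by
      rw [hv, Complex.im_ofReal_mul, Complex.sub_im, Complex.exp_im]
      simp; ring
    rcases le_total c (2 / 5) with h | h
    · apply notMem_region_of_normSq
      rw [Complex.normSq_apply, hre, him]
      have h2 := le_normSq_one_sub_exp_neg hs h
      have h3 : 5 / 2 ≤ (μ * e) ^ 2 := by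
        have : μ * e = 1 + μ := by linear_combination hμe
        rw [this]; nlinarith
      nlinarith
    · obtain ⟨t, ht⟩ : ∃ t, t = 1 - c := ⟨_, rfl⟩
      have ht0 : 0 ≤ t := by linarith
      have ht1 : t ≤ 3 / 5 := by linarith
      have hst : s ^ 2 = 2 * t - t ^ 2 := by rw [hs, ht]; ring
      have hE : e * Real.exp (-c) = Real.exp t := by
        rw [he, ← Real.exp_add, ht]; congr 1
      obtain ⟨X, hX⟩ : ∃ X, X = 1 + μ - μ * (Real.exp t * Real.cos s) := ⟨_, rfl⟩
      obtain ⟨Y, hY⟩ : ∃ Y, Y = μ * (Real.exp t * Real.sin s) := ⟨_, rfl⟩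
      have hre' : v.re = 8 / 9 * X := by
        rw [hre, hX, ← hE]; linear_combination 8 / 9 * hμe
      have him' : v.im = 8 / 9 * Y := by
        rw [him, hY, ← hE]; ring
      have hXle : 1 - X ≤ 7 / 20 * μ * t ^ 2 := by
        have := mul_le_mul_of_nonneg_left (exp_mul_cos_le ht0 ht1 hst) (by linarith : 0 ≤ μ)
        rw [hX]; linarith
      have hYle : 2 * μ ^ 2 * t ≤ Y ^ 2 := by
        have := mul_le_mul_of_nonneg_left (two_mul_le_exp_mul_sin_sq ht0 ht1 hst) (sq_nonneg μ)
        rw [hY, mul_pow]; linarith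
      obtain ⟨hQ0, hQ⟩ := le_mul_sq_of_near_right_endpoint hμ1 ht0 ht1 hXle hYle
      rw [notMem_nephroidPrimitiveRegion, Complex.normSq_apply, hre', him']
      have e1 : 8 / 9 * X * (8 / 9 * X) + 8 / 9 * Y * (8 / 9 * Y) - 64 / 81 =
          64 / 81 * (X ^ 2 + Y ^ 2 - 1) := by ring
      rw [e1]
      exact ⟨by linarith, by linarith⟩
  · rw [h1]
    have h2 : 8 / 9 * (μ * e) * (1 - e⁻¹) = 8 / 9 * 1 := by
      field_simp
      linarith
    exact ofReal_mul_one_sub_inv h2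

theorem mainTheorem7 :
    (SharpSubordinationBound phiCrescent (4 / 9 * (2 + Real.sqrt 2)) ∧
      SharpSubordinationBound phiCardioid (4 / 3) ∧
      SharpSubordinationBound phiLimacon (8 / 63 * (5 + 4 * Real.sqrt 2)) ∧
      SharpSubordinationBound Complex.exp (8 * Real.exp 1 / (9 * (Real.exp 1 - 1))) ∧
      SharpSubordinationBound phiSin (8 * (1 + Real.sin 1) / (9 * Real.sin 1)) ∧
      SharpSubordinationBound phiZero (16 / 9 * (1 + Real.sqrt 2)) ∧
      SharpSubordinationBound phiNe (20 / 9)) ∧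
    (SharpStarlikeBound phiCrescent (4 / 9 * (2 + Real.sqrt 2)) ∧
      SharpStarlikeBound phiCardioid (4 / 3) ∧
      SharpStarlikeBound phiLimacon (8 / 63 * (5 + 4 * Real.sqrt 2)) ∧
      SharpStarlikeBound Complex.exp (8 * Real.exp 1 / (9 * (Real.exp 1 - 1))) ∧
      SharpStarlikeBound phiSin (8 * (1 + Real.sin 1) / (9 * Real.sin 1)) ∧
      SharpStarlikeBound phiZero (16 / 9 * (1 + Real.sqrt 2)) ∧
      SharpStarlikeBound phiNe (20 / 9)) := by
  have h2 : 0 < √2 := by positivity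
  have hS : 0 < Real.sin 1 := Real.sin_pos_of_pos_of_lt_pi one_pos (by linarith [Real.pi_gt_three])
  have he : 0 < Real.exp 1 - 1 := by linarith [Real.exp_one_gt_d9]
  exact ⟨⟨sharpSubordinationBound_phiCrescent, sharpSubordinationBound_phiCardioid,
    sharpSubordinationBound_phiLimacon, sharpSubordinationBound_exp,
    sharpSubordinationBound_phiSin, sharpSubordinationBound_phiZero,
    sharpSubordinationBound_phiNe⟩,
    sharpSubordinationBound_phiCrescent.sharpStarlikeBound (by positivity),
    sharpSubordinationBound_phiCardioid.sharpStarlikeBound (by norm_num),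
    sharpSubordinationBound_phiLimacon.sharpStarlikeBound (by positivity),
    sharpSubordinationBound_exp.sharpStarlikeBound (by positivity),
    sharpSubordinationBound_phiSin.sharpStarlikeBound (by positivity),
    sharpSubordinationBound_phiZero.sharpStarlikeBound (by positivity),
    sharpSubordinationBound_phiNe.sharpStarlikeBound (by norm_num)⟩
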